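/- Let $0<q<1$. For $a\in\mathbb C$ put $(a;q)_j=\prod_{i=0}^{j-1}(1-aq^i)$ for $j\ge 0$, $(a;q)_{-j}=1/(aq^{-j};q)_j$ for $j\ge1$, $(a;q)_\infty=\prod_{i\ge0}(1-aq^i)$, with the convention $1/(q;q)_j=0$ for $j<0$. Let $${}_r\phi_s(a_1,\dots,a_r;b_1,\dots,b_s;q,z)=\sum_{j\ge0}\frac{(a_1;q)_j\cdots(a_r;q)_j}{(q;q)_j(b_1;q)_j\cdots(b_s;q)_j}\{(-1)^jq^{\binom j2}\}^{1+s-r}z^j ,$$ and let Jackson's second $q$-Bessel function be $$J^{(2)}_\nu(x;q)=\frac{(q^{\nu+1};q)_\infty}{(q;q)_\infty}\Big(\frac x2\Big)^\nu\,{}_0\phi_1\Big(-;q^{\nu+1};q,-\frac{x^2q^{\nu+1}}4\Big)$$ with the principal branch of the power. Here $\binom m2=m(m-1)/2$ for every integer $m$. For integers $m,n$ and $\nu\in\mathbb C$ let $g_{m,n}=\lfloor\frac{m+n+1}2\rfloor-\min\{m,n,m+n,0\}-1$ (which is $\ge-1$), and $$P^{(2)}_{m,n,\nu}(x;q)=\sum_{j=0}^{g_{m,n}}\Big(\frac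 x2\Big)^{2j}(-1)^jq^{j\nu}\,\big(a_{j+\min\{m,0\}}-b_{j-\max\{m,0\}}\big),$$ where for $n\ge0$ $$a_j=\frac{(q^\nu;q)_m}{(q;q)_j(q^{2-\nu};q)_{j-m}}q^{(j-m+1)n-(j-m+n)\nu}{}_2\phi_1(q^{-j},q^{\nu+m-j-1};q^\nu;q,q^{2j-m-n+1}),$$ $$b_j=\frac{1}{(q;q)_j(q^{2-\nu};q)_j}q^{j(j+1)-2j\nu}{}_2\phi_1(q^{-j},q^{\nu-j-1};q^{\nu+m};q,q^{n+1}),$$ and for $n<0$ $$a_j=\frac{(q^\nu;q)_m}{(q;q)_j(q^{2-\nu};q)_{j-m}}q^{(j-m+1)(j+n)-(2j-m+n)\nu}{}_2\phi_1(q^{-j},q^{\nu+m-j-1};q^\nu;q,q^{1-n}),$$ $$b_j=\frac{1}{(q;q)_j(q^{2-\nu};q)_j}q^{-j\nu}{}_2\phi_1(q^{-j},q^{\nu-j-1};q^{\nu+m};q,q^{2j+m+n+1})$$ (so $a_j=b_j=0$ for $j<0$). Put $$R^{(2)}_{m,n,\nu}(x;q)=\frac{(q^{\nu+m+1};q)_\infty}{(q^{\nu-1};q)_\infty(-x^2/4;q)_{\max\{n,0\}}}(-1)^{\max\{m+1,0\}}q^{\min\{m+1,0\}\nu+\binom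 m2-1}\Big(\frac x2\Big)^{\min\{m+2,-m\}}P^{(2)}_{m+1,n,\nu}(x;q).$$ (a) For all integers $m,n$, $$q^{-\frac{(\nu+m)n}2+m\nu+\binom m2}J^{(2)}_{\nu+m}(xq^{n/2};q)=R^{(2)}_{m,n,\nu}(x;q)J^{(2)}_\nu(x;q)-R^{(2)}_{m-1,n,\nu+1}(x;q)J^{(2)}_{\nu-1}(x;q)$$ for all complex $\nu$ and $x\neq0$ for which no denominator in these expressions vanishes, that is, $(q^{\nu-1};q)_\infty\ne0$, $(q^{\nu+m+1};q)_\infty\neq0$, $(-x^2/4;q)_{\max\{n,0\}}\ne0$ and $(q^{2-\nu};q)_N\ne0$ with $N=\max\{g_{m+1,n}-\max\{m+1,0\},0\}$. (b) $P^{(2)}_{m,n,\nu}(x;q)$ is a polynomial in $x^2$ of degree at most $g_{m,n}$ (the zero polynomial if $g_{m,n}=-1$). (c) For $n=0$, every integer $m\ge0$, $x\ne0$ and $(q^{\nu-1};q)_\infty\ne0$, $R^{(2)}_{m,0,\nu}(x;q)$ is Ismail's $q$-Lommel polynomial: $$R^{(2)}_{m,0,\nu}(x;q)=\sum_{j=0}^{\lfloor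 m/2\rfloor}\Big(\frac x2\Big)^{2j-m}\frac{(-1)^j(q^\nu;q)_{m-j}(q;q)_{m-j}}{(q;q)_j(q^\nu;q)_j(q;q)_{m-2j}}q^{j(\nu+j-1)}.$$ -/

import Mathlib

noncomputable section

namespace QBessel

/-- The `q`-shifted factorial `(a; q)_j` for an integer `j`:
`(a; q)_j = (1 - a)(1 - a q) ⋯ (1 - a q^(j-1))` for `j ≥ 0`, and
`(a; q)_{-j} = 1 / (a q^(-j); q)_j` for `j ≥ 1`. In particular `(q; q)_{-j}` is `1 / 0 = 0`
for `j ≥ 1`, so that dividing by it gives `0`, which is the usual convention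
`1 / (q; q)_{-j} = 0`. -/
def qPoch (a q : ℂ) : ℤ → ℂ
  | Int.ofNat j => ∏ i ∈ Finset.range j, (1 - a * q ^ i)
  | Int.negSucc j => 1 / ∏ i ∈ Finset.range (j + 1), (1 - a * q ^ (-((j : ℤ) + 1)) * q ^ i)

/-- The infinite `q`-shifted factorial `(a; q)_∞ = ∏_{j ≥ 0} (1 - a q^j)` (for `|q| < 1`). -/
def qPochInf (a q : ℂ) : ℂ := ∏' j : ℕ, (1 - a * q ^ j)

/-- The basic hypergeometric series `_rφ_s (a₁, …, a_r; b₁, …, b_s; q, z)`. -/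
def basicHyp (as bs : List ℂ) (q z : ℂ) : ℂ :=
  ∑' j : ℕ, (as.map fun a => qPoch a q j).prod / (qPoch q q j * (bs.map fun b => qPoch b q j).prod)
    * ((-1) ^ j * q ^ (j.choose 2)) ^ (1 + (bs.length : ℤ) - (as.length : ℤ)) * z ^ j

/-- Jackson's second `q`-Bessel function `J^(2)_ν(x; q)`, with principal powers. -/
def J2 (q : ℝ) (ν x : ℂ) : ℂ :=
  qPochInf ((q : ℂ) ^ (ν + 1)) q / qPochInf q q * (x / 2) ^ ν
    * basicHyp [] [(q : ℂ) ^ (ν + 1)] q (-(x ^ 2 * (q : ℂ) ^ (ν + 1)) / 4)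

/-- `⌊(m + n + 1) / 2⌋ - min {m, n, m + n, 0} - 1` -/
def g (m n : ℤ) : ℤ := (m + n + 1) / 2 - min (min m n) (min (m + n) 0) - 1

/-- The coefficients `A^(2)_{m,n,ν,j}`. -/
def coeffA (q : ℝ) (m n : ℤ) (ν : ℂ) (j : ℤ) : ℂ :=
  qPoch ((q : ℂ) ^ ν) q m / (qPoch q q j * qPoch ((q : ℂ) ^ (2 - ν)) q (j - m))
    * (q : ℂ) ^ ((((j - m + 1) * n : ℤ) : ℂ) - ((j - m + n : ℤ) : ℂ) * ν)
    * basicHyp [(q : ℂ) ^ (-j), (q : ℂ) ^ (ν + m - j - 1)] [(q : ℂ) ^ ν] q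
        ((q : ℂ) ^ (2 * j - m - n + 1))

/-- The coefficients `B^(2)_{m,n,ν,j}`. -/
def coeffB (q : ℝ) (m n : ℤ) (ν : ℂ) (j : ℤ) : ℂ :=
  1 / (qPoch q q j * qPoch ((q : ℂ) ^ (2 - ν)) q j)
    * (q : ℂ) ^ (((j * (j + 1) : ℤ) : ℂ) - ((2 * j : ℤ) : ℂ) * ν)
    * basicHyp [(q : ℂ) ^ (-j), (q : ℂ) ^ (ν - j - 1)] [(q : ℂ) ^ (ν + m)] q
        ((q : ℂ) ^ (n + 1))

/-- The coefficients `Ã^(2)_{m,n,ν,j}`. -/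
def coeffA' (q : ℝ) (m n : ℤ) (ν : ℂ) (j : ℤ) : ℂ :=
  qPoch ((q : ℂ) ^ ν) q m / (qPoch q q j * qPoch ((q : ℂ) ^ (2 - ν)) q (j - m))
    * (q : ℂ) ^ ((((j - m + 1) * (j + n) : ℤ) : ℂ) - ((2 * j - m + n : ℤ) : ℂ) * ν)
    * basicHyp [(q : ℂ) ^ (-j), (q : ℂ) ^ (ν + m - j - 1)] [(q : ℂ) ^ ν] q
        ((q : ℂ) ^ (1 - n))

/-- The coefficients `B̃^(2)_{m,n,ν,j}`. -/
def coeffB' (q : ℝ) (m n : ℤ) (ν : ℂ) (j : ℤ) : ℂ :=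
  1 / (qPoch q q j * qPoch ((q : ℂ) ^ (2 - ν)) q j)
    * (q : ℂ) ^ (-((j : ℂ) * ν))
    * basicHyp [(q : ℂ) ^ (-j), (q : ℂ) ^ (ν - j - 1)] [(q : ℂ) ^ (ν + m)] q
        ((q : ℂ) ^ (2 * j + m + n + 1))

/-- `P^(2)_{m,n,ν}(x; q)`, a sum over `0 ≤ j ≤ g m n`. -/
def P2 (q : ℝ) (m n : ℤ) (ν x : ℂ) : ℂ :=
  ∑ j ∈ Finset.range (g m n + 1).toNat,
    (x / 2) ^ (2 * j) * (-1) ^ j * (q : ℂ) ^ ((j : ℂ) * ν) *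
      (if 0 ≤ n then coeffA q m n ν (j + min m 0) - coeffB q m n ν (j - max m 0)
        else coeffA' q m n ν (j + min m 0) - coeffB' q m n ν (j - max m 0))

/-- `R^(2)_{m,n,ν}(x; q)`. -/
def R2 (q : ℝ) (m n : ℤ) (ν x : ℂ) : ℂ :=
  qPochInf ((q : ℂ) ^ (ν + m + 1)) q
      / (qPochInf ((q : ℂ) ^ (ν - 1)) q * qPoch (-x ^ 2 / 4) q (max n 0))
    * (-1) ^ (max (m + 1) 0)
    * (q : ℂ) ^ (((min (m + 1) 0 : ℤ) : ℂ) * ν + (m : ℂ) * ((m : ℂ) - 1) / 2 - 1)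
    * (x / 2) ^ (min (m + 2) (-m)) * P2 q (m + 1) n ν x

/-- Ismail's `q`-Lommel polynomial `R_{m,ν}(x; q)` (a polynomial in `1 / x`), in its explicit
form. -/
def ismailLommel (q : ℝ) (m : ℕ) (ν x : ℂ) : ℂ :=
  ∑ j ∈ Finset.range (m / 2 + 1),
    (x / 2) ^ (2 * (j : ℤ) - (m : ℤ)) *
      ((-1) ^ j * qPoch ((q : ℂ) ^ ν) q ((m : ℤ) - j) * qPoch q q ((m : ℤ) - j)
        / (qPoch q q j * qPoch ((q : ℂ) ^ ν) q j * qPoch q q ((m : ℤ) - 2 * j)))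
      * (q : ℂ) ^ ((j : ℂ) * (ν + j - 1))

/-- No denominator in `R^(2)_{m,n,ν}(x; q)` and `R^(2)_{m-1,n,ν+1}(x; q)`, and no lower parameter of
a series in them or in `J^(2)_{ν+m}`, `J^(2)_ν`, `J^(2)_{ν-1}`, is degenerate, and `x ≠ 0`. -/
structure Admissible (q : ℝ) (m n : ℤ) (ν x : ℂ) : Prop where
  /-- `(x / 2)^ν` and negative powers of `x` are defined. -/
  x_ne : x ≠ 0
  /-- `(-x² / 4; q)_{max {n, 0}} ≠ 0` -/
  x_reg : qPoch (-x ^ 2 / 4) q (max n 0) ≠ 0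
  /-- `(q^(ν-1); q)_∞ ≠ 0`; hence `q^ν`, `q^(ν+1)` are allowed lower parameters. -/
  ν_reg : ∀ k : ℕ, (q : ℂ) ^ (ν - 1 + k) ≠ 1
  /-- `q^(ν+m+1)` is an allowed lower parameter. -/
  νm_reg : ∀ k : ℕ, (q : ℂ) ^ (ν + m + 1 + k) ≠ 1
  /-- The factors `(q^(2-ν); q)_i` in the denominators of the coefficients do not vanish: the
  largest index `i` that occurs in `P^(2)_{m+1,n,ν}` is `g (m + 1) n - max {m + 1, 0}`
  (and this covers the factors `(q^(1-ν); q)_i` in `P^(2)_{m,n,ν+1}`). -/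
  coeff_reg : qPoch ((q : ℂ) ^ (2 - ν)) q (max (g (m + 1) n - max (m + 1) 0) 0) ≠ 0

end QBessel

end

/-! Put u = q^ν and z = (x/2)². Up to prefactors, the second `q`-Bessel function is the power series
`ser2` in z, and Jackson's first one is `ser1`; they differ by the factor (-z;q)_∞
(`serE_mul_ser1`).

The coefficients a_j and b_j are, up to elementary factors, the Taylor coefficients of two products:
one pairs the parameters u and q^(2-M)/u, the other q²/u and u q^M, with arguments z and q^n z. For
n ≥ 0 the factor at z is of the second kind and the one at q^n z of the first kind; for n < 0 the
kinds are exchanged. The difference of the products is a polynomial because a_j and b_{j-M} are the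
two halves of one partial fraction sum: the numerator is a monomial X^s and the nodes are q^i (i ≤
j) and q^(l+1)/u (l ≤ j-M). The total vanishes once s is at least two below the number of nodes
(`sumA_eq_sumB`, and `sumA_eq_zero`, `sumB_eq_zero` when one family is empty). This happens for
every index beyond `g`, so the truncated sum P is the full difference of products (`serP_eq`).

For M = 1, n = 0 the polynomial is constant, which is a Casoratian identity for free (`casorati`).
After inserting `serP_eq` into the right side of the three-term relation, the products containing
q^(1-m)/u cancel, and the rest is the Casoratian times the series of J_{ν+m}
(`seriesRelation_of_generic`).

All this assumes that u is not an integral power of q. Every coefficient of z^k in the relation is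
continuous in u at admissible points and generic u are dense, so the relation extends
(`seriesRelation`); evaluating the series at z gives (a). Part (b) is read off the defining sum. In
(c) the b_j are absent and the ₂φ₁ in a_j is summed by `q`-Chu-Vandermonde. -/

namespace QBessel

/-! ### Finite `q`-shifted factorials -/

section

open Finset

/-- The finite `q`-shifted factorial `(a; q)_k` for `k : ℕ`. -/
noncomputable def poch (a q : ℂ) (k : ℕ) : ℂ := ∏ i ∈ range k, (1 - a * q ^ i)

/-- The triangular number `k (k - 1) / 2`, for an integer `k`. -/
def tri (k : ℤ) : ℤ := k * (k - 1) / 2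

theorem two_mul_tri (k : ℤ) : 2 * tri k = k * (k - 1) := by
  unfold tri
  have h : (2 : ℤ) ∣ k * (k - 1) := (Int.even_mul_pred_self k).two_dvd
  omega

theorem tri_add (a b : ℤ) : tri (a + b) = tri a + tri b + a * b := by
  have h1 := two_mul_tri a
  have h2 := two_mul_tri b
  have h3 := two_mul_tri (a + b)
  have h : 2 * tri (a + b) = 2 * (tri a + tri b + a * b) := by
    linear_combination h3 - h1 - h2
  omega

theorem tri_sub (a b : ℤ) : tri (a - b) = tri a + tri b + b - a * b := by
  have h1 := two_mul_tri a
  have h2 := two_mul_tri b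
  have h3 := two_mul_tri (a - b)
  have h : 2 * tri (a - b) = 2 * (tri a + tri b + b - a * b) := by
    linear_combination h3 - h1 - h2
  omega

theorem tri_natCast (k : ℕ) : tri k = (k.choose 2 : ℤ) := by
  rw [Nat.choose_two_right]
  rcases k with _ | k
  · simp [tri]
  · unfold tri
    push_cast
    simp

@[simp] theorem tri_zero : tri 0 = 0 := rfl

@[simp] theorem tri_one : tri 1 = 0 := rfl

@[simp] theorem poch_zero (a q : ℂ) : poch a q 0 = 1 := rfl

theorem poch_succ (a q : ℂ) (k : ℕ) : poch a q (k + 1) = poch a q k * (1 - a * q ^ k) :=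
  prod_range_succ _ _

theorem poch_succ' (a q : ℂ) (k : ℕ) : poch a q (k + 1) = (1 - a) * poch (a * q) q k := by
  unfold poch
  rw [prod_range_succ', mul_comm]
  simp [pow_succ', mul_assoc]

theorem poch_add (a q : ℂ) (k l : ℕ) : poch a q (k + l) = poch a q k * poch (a * q ^ k) q l := by
  unfold poch
  rw [prod_range_add]
  simp [pow_add, mul_assoc]

theorem poch_ne_zero {a q : ℂ} {k : ℕ} (h : ∀ i < k, a * q ^ i ≠ 1) : poch a q k ≠ 0 :=
  prod_ne_zero_iff.2 fun i hi => sub_ne_zero.2 (h i (mem_range.1 hi)).symm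

theorem qPoch_natCast (a q : ℂ) (k : ℕ) : qPoch a q (k : ℤ) = poch a q k := rfl

@[simp] theorem qPoch_zero (a q : ℂ) : qPoch a q 0 = 1 := by
  simpa using qPoch_natCast a q 0

theorem qPoch_neg_natCast (a q : ℂ) (k : ℕ) :
    qPoch a q (-(k : ℤ)) = 1 / poch (a * q ^ (-(k : ℤ))) q k := by
  rcases k with _ | k
  · simp
  · rfl

theorem qPoch_self_neg {q : ℂ} (hq : q ≠ 0) {k : ℤ} (hk : k < 0) : qPoch q q k = 0 := by
  obtain ⟨n, rfl⟩ : ∃ n : ℕ, k = -((n + 1 : ℕ) : ℤ) := ⟨(-k - 1).toNat, by omega⟩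
  rw [qPoch_neg_natCast, poch, prod_eq_zero (self_mem_range_succ n), div_zero]
  rw [← zpow_natCast, mul_assoc, ← zpow_add₀ hq, ← zpow_one_add₀ hq]
  simp

/-- `u` is generic if it is not an integral power of `q`. -/
def Generic (q u : ℂ) : Prop := ∀ k : ℤ, u * q ^ k ≠ 1

theorem Generic.mul_zpow {q u : ℂ} (hq : q ≠ 0) (h : Generic q u) (k : ℤ) :
    Generic q (u * q ^ k) := fun l => by
  rw [mul_assoc, ← zpow_add₀ hq]; exact h _

theorem Generic.zpow_div {q u : ℂ} (hq : q ≠ 0) (hu : u ≠ 0) (h : Generic q u) (k : ℤ) :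
    Generic q (q ^ k / u) := fun l hl => by
  refine h (-k - l) ?_
  rw [div_mul_eq_mul_div, div_eq_one_iff_eq hu, ← zpow_add₀ hq] at hl
  rw [← hl, ← zpow_add₀ hq]
  simp

theorem Generic.poch_ne_zero {q u : ℂ} (h : Generic q u) (k : ℕ) : poch u q k ≠ 0 :=
  QBessel.poch_ne_zero fun i _ => by simpa using h i

/-- Genericity matters for negative k: if the first factor of the denominator vanished, the value
1/0 = 0 would break the rule. -/
theorem qPoch_add_one {q a : ℂ} (hq : q ≠ 0) (h : Generic q a) (k : ℤ) :
    qPoch a q (k + 1) = qPoch a q k * (1 - a * q ^ k) := by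
  rcases k with k | k
  · exact poch_succ a q k
  · rw [show (Int.negSucc k : ℤ) = -((k + 1 : ℕ) : ℤ) from rfl,
      show (-((k + 1 : ℕ) : ℤ) + 1 : ℤ) = -(k : ℤ) by push_cast; ring,
      qPoch_neg_natCast, qPoch_neg_natCast, poch_succ', mul_assoc a, ← zpow_add_one₀ hq,
      show (-((k + 1 : ℕ) : ℤ) + 1 : ℤ) = -(k : ℤ) by push_cast; ring]
    have h1 := sub_ne_zero.2 (h (-((k + 1 : ℕ) : ℤ))).symm
    field_simp

theorem Generic.qPoch_ne_zero {q a : ℂ} (hq : q ≠ 0) (h : Generic q a) (k : ℤ) :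
    qPoch a q k ≠ 0 := by
  obtain ⟨n, rfl | rfl⟩ := k.eq_nat_or_neg
  · rw [qPoch_natCast]; exact h.poch_ne_zero n
  · rw [qPoch_neg_natCast]; exact one_div_ne_zero ((h.mul_zpow hq _).poch_ne_zero n)

theorem qPoch_add_natCast {q a : ℂ} (hq : q ≠ 0) (h : Generic q a) (k : ℤ) (n : ℕ) :
    qPoch a q (k + n) = qPoch a q k * poch (a * q ^ k) q n := by
  induction n with
  | zero => simp
  | succ n ih =>
    rw [Nat.cast_succ, ← add_assoc, qPoch_add_one hq h, ih, poch_succ, zpow_add₀ hq, zpow_natCast]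
    ring

/-- A nonvanishing ratio lets the recurrence run backwards, so the value at 0 determines the
sequence on all of ℤ. -/
theorem eq_of_int_recurrence {f g r : ℤ → ℂ} (hr : ∀ k, r k ≠ 0) (h0 : f 0 = g 0)
    (hf : ∀ k, f (k + 1) = f k * r k) (hg : ∀ k, g (k + 1) = g k * r k) (k : ℤ) : f k = g k := by
  induction k using Int.induction_on with
  | zero => exact h0
  | succ n ih => rw [hf, hg, ih]
  | pred n ih =>
    have h1 := hf (-(n : ℤ) - 1)
    have h2 := hg (-(n : ℤ) - 1)
    rw [sub_add_cancel] at h1 h2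
    exact mul_right_cancel₀ (hr _) (h1.symm.trans (ih.trans h2))

/-- Reversal of a `q`-shifted factorial. -/
theorem qPoch_zpow_div {q u : ℂ} (hq : q ≠ 0) (hu : u ≠ 0) (h : Generic q u) (N k : ℤ) :
    qPoch (q ^ (1 - N) / u) q k
      = (-1) ^ k * u ^ (-k) * q ^ ((1 - N) * k + tri k) * qPoch u q N / qPoch u q (N - k) := by
  have hg := h.zpow_div hq hu (1 - N)
  refine eq_of_int_recurrence (f := fun k => qPoch (q ^ (1 - N) / u) q k)
    (g := fun k => (-1) ^ k * u ^ (-k) * q ^ ((1 - N) * k + tri k) * qPoch u q N / qPoch u q (N - k))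
    (r := fun k => 1 - q ^ (1 - N) / u * q ^ k)
    (fun k => sub_ne_zero.2 (hg k).symm) ?_ (fun k => qPoch_add_one hq hg k) (fun k => ?_) k
  · simp [h.qPoch_ne_zero hq N]
  · have h1 := qPoch_add_one hq h (N - (k + 1))
    rw [show N - (k + 1) + 1 = N - k by ring] at h1
    have h3 := sub_ne_zero.2 (h (N - (k + 1))).symm
    have h5 : q ^ (1 - N) / u * q ^ k = (q ^ (N - (k + 1)))⁻¹ / u := by
      rw [div_mul_eq_mul_div, ← zpow_add₀ hq, ← zpow_neg]
      congr 2
      ring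
    rw [h1, tri_add, tri_one, neg_add, zpow_add₀ hu, zpow_add₀ (by norm_num : (-1 : ℂ) ≠ 0),
      show (1 - N) * (k + 1) + (tri k + 0 + k * 1) = ((1 - N) * k + tri k) + -(N - (k + 1)) by ring,
      zpow_add₀ hq _ (-(N - (k + 1))), h5, zpow_neg q (N - (k + 1)), zpow_neg_one, zpow_one]
    have h4 : q ^ (N - (k + 1)) ≠ 0 := zpow_ne_zero _ hq
    generalize q ^ (N - (k + 1)) = t at *
    field_simp
    ring

end

/-! ### Partial fractions -/

section

open Finset Polynomial

/-- By Lagrange interpolation the sum is the coefficient of p at X^(#s - 1), and this exceeds the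
degree of p. -/
theorem sum_eval_div_prod_eq_zero {ι : Type*} [DecidableEq ι] {s : Finset ι} {v : ι → ℂ}
    (hv : Set.InjOn v s) {p : ℂ[X]} (hp : p.natDegree + 1 < #s) :
    ∑ i ∈ s, p.eval (v i) / ∏ k ∈ s.erase i, (v i - v k) = 0 := by
  rw [← Lagrange.coeff_eq_sum hv]
  · exact coeff_eq_zero_of_natDegree_lt (by omega)
  · exact lt_of_le_of_lt degree_le_natDegree (by exact_mod_cast (by omega : p.natDegree < #s))

theorem prod_range_pow_sub_pow (q : ℂ) (i : ℕ) :
    ∏ k ∈ range i, (q ^ i - q ^ k) = (-1) ^ i * q ^ (i.choose 2) * poch q q i := by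
  induction i with
  | zero => simp
  | succ i ih =>
    have h : ∀ k ∈ range i, (q ^ (i + 1) - q ^ (k + 1)) = q * (q ^ i - q ^ k) := fun k _ => by ring
    rw [prod_range_succ', prod_congr rfl h, prod_mul_distrib, ih, poch_succ,
      Nat.choose_succ_succ' i 1]
    simp
    ring

/-- The nodes below i contribute (q;q)_i and those above contribute (q;q)_(j-i), each up to a sign
or power of q. -/
theorem prod_erase_pow_sub_pow (q : ℂ) {i j : ℕ} (hij : i ≤ j) :
    ∏ k ∈ (range (j + 1)).erase i, (q ^ i - q ^ k)
      = (-1) ^ i * (q ^ (tri i + i * (j - i)) * (poch q q i * poch q q (j - i))) := by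
  obtain ⟨d, rfl⟩ := Nat.exists_eq_add_of_le hij
  have h1 : ∏ k ∈ (range (i + d + 1)).erase i, (q ^ i - q ^ k)
      = ∏ k ∈ range (i + d + 1), (if k = i then 1 else (q ^ i - q ^ k)) :=
    (prod_congr rfl fun k hk => by rw [if_neg (ne_of_mem_erase hk)]).trans
      (prod_erase (a := i) _ (by simp))
  rw [h1, show i + d + 1 = i + 1 + d by ring, prod_range_add, prod_range_succ]
  have h2 : ∀ k ∈ range i, (if k = i then 1 else (q ^ i - q ^ k)) = q ^ i - q ^ k := fun k hk => by
    simp [(mem_range.1 hk).ne]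
  have h3 : ∀ k ∈ range d, (if i + 1 + k = i then 1 else (q ^ i - q ^ (i + 1 + k)))
      = q ^ i * (1 - q * q ^ k) := fun k _ => by
    rw [if_neg (by omega)]; ring
  rw [prod_congr rfl h2, prod_congr rfl h3, prod_range_pow_sub_pow, prod_mul_distrib, prod_const,
    card_range, tri_natCast, add_tsub_cancel_left]
  have h4 : (((i.choose 2 : ℕ) : ℤ) + (i : ℤ) * (((i + d : ℕ) : ℤ) - i))
      = ((i.choose 2 + i * d : ℕ) : ℤ) := by push_cast; ring
  rw [h4, zpow_natCast, pow_add, pow_mul]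
  simp [poch]
  ring

/-- The sum to which the coefficients `a_j` of the `q`-Lommel polynomials are proportional. -/
noncomputable def sumA (q u : ℂ) (s : ℤ) (j : ℕ) (b : ℤ) : ℂ :=
  ∑ i ∈ range (j + 1), (-1) ^ i * q ^ (s * i - tri i - i * (j - i)) * qPoch u q (i - 1 - b)
    / (qPoch u q i * poch q q i * poch q q (j - i))

/-- The sum to which the coefficients `b_j` of the `q`-Lommel polynomials are proportional. -/
noncomputable def sumB (q u : ℂ) (s : ℤ) (j : ℤ) (b : ℕ) : ℂ :=
  ∑ l ∈ range (b + 1), (-1) ^ l * q ^ (s * l - (j + 1) * l - tri l - l * (b - l))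
    * qPoch u q (-1 - l) / (qPoch u q (j - l) * poch q q l * poch q q (b - l))

theorem neg_one_pow_div (i : ℕ) (x y : ℂ) : x / ((-1) ^ i * y) = (-1) ^ i * x / y := by
  rcases neg_one_pow_eq_or ℂ i with h | h <;> rw [h] <;> simp [neg_div, div_neg]

theorem pow_injOn {q : ℂ} (hq : q ≠ 0) (hq1 : ∀ k : ℤ, k ≠ 0 → q ^ k ≠ 1) {m n : ℤ}
    (h : q ^ m = q ^ n) : m = n := by
  by_contra hne
  refine hq1 (m - n) (sub_ne_zero.2 hne) ?_
  rw [zpow_sub₀ hq, h, div_self (zpow_ne_zero _ hq)]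

/-- The cross factors of a node q^i against the other family. They form a block of consecutive
factors 1 - u q^k, hence a quotient of two factorials whose indices may be negative. -/
theorem prod_pow_sub_node {q u : ℂ} (hq : q ≠ 0) (h : Generic q u) (hu : u ≠ 0) (i b : ℕ) :
    ∏ l ∈ range (b + 1), (q ^ i - q / u * q ^ l)
      = (-1) ^ (b + 1) * ((q / u) ^ ((b : ℤ) + 1) * q ^ tri (b + 1) * qPoch u q i
        / qPoch u q (i - 1 - b)) := by
  have h1 := h.qPoch_ne_zero hq (i - 1 - b)
  have h2 := qPoch_add_natCast hq h (i - 1 - b) (b + 1)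
  rw [show (i - 1 - b : ℤ) + ((b + 1 : ℕ) : ℤ) = i by push_cast; ring] at h2
  rw [h2, mul_left_comm _ (qPoch u q (i - 1 - b)), mul_div_cancel_left₀ _ h1, ← mul_assoc, ← mul_assoc]
  have h3 : poch (u * q ^ (i - 1 - b : ℤ)) q (b + 1)
      = ∏ l ∈ range (b + 1), (1 - u * q ^ (i - 1 - l : ℤ)) := by
    rw [poch, ← prod_range_reflect]
    refine prod_congr rfl fun l hl => ?_
    have hl : l ≤ b := by simpa [Nat.lt_succ_iff] using hl
    rw [← zpow_natCast, mul_assoc, ← zpow_add₀ hq, show b + 1 - 1 - l = b - l by omega]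
    push_cast [hl]
    congr 3
    ring
  have h4 : (-1) ^ (b + 1) * (q / u) ^ ((b : ℤ) + 1) * q ^ tri (b + 1)
      = ∏ l ∈ range (b + 1), (-(q / u) * q ^ l) := by
    rw [prod_mul_distrib, prod_const, card_range, neg_pow (q / u), prod_pow_eq_pow_sum, sum_range_id,
      ← Nat.choose_two_right, ← zpow_natCast q, ← tri_natCast, ← zpow_natCast (q / u)]
    push_cast
    rfl
  rw [h3, h4, ← prod_mul_distrib]
  refine prod_congr rfl fun l _ => ?_
  rw [← zpow_natCast, ← zpow_natCast, zpow_sub₀ hq, zpow_sub₀ hq, zpow_one]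
  have : q ^ (l : ℤ) ≠ 0 := zpow_ne_zero _ hq
  field_simp
  ring

theorem prod_node_sub_pow {q u : ℂ} (hq : q ≠ 0) (h : Generic q u)
    (hu : u ≠ 0) (l j : ℕ) :
    ∏ i ∈ range (j + 1), (q / u * q ^ l - q ^ i)
      = (q / u * q ^ l) ^ ((j : ℤ) + 1) * qPoch u q (j - l) / qPoch u q (-1 - l) := by
  have h1 := h.qPoch_ne_zero hq (-1 - l)
  have h2 := qPoch_add_natCast hq h (-1 - l) (j + 1)
  rw [show (-1 - l : ℤ) + ((j + 1 : ℕ) : ℤ) = j - l by push_cast; ring] at h2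
  rw [h2, mul_left_comm, mul_div_cancel_left₀ _ h1,
    show (j : ℤ) + 1 = ((j + 1 : ℕ) : ℤ) by push_cast; rfl, zpow_natCast, poch,
    ← card_range (j + 1), ← prod_const, card_range, ← prod_mul_distrib]
  refine prod_congr rfl fun i _ => ?_
  rw [← zpow_natCast q l, zpow_sub₀ hq, zpow_neg_one]
  have : q ^ (l : ℤ) ≠ 0 := zpow_ne_zero _ hq
  field_simp

section

variable {q u : ℂ} (hq : q ≠ 0) (hq1 : ∀ k : ℤ, k ≠ 0 → q ^ k ≠ 1) (h : Generic q u)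

include hq hq1

theorem natPow_injOn (s : Set ℕ) : Set.InjOn (fun i : ℕ => q ^ i) s := fun i _ j _ hij => by
  have : q ^ (i : ℤ) = q ^ (j : ℤ) := by simpa using hij
  exact_mod_cast pow_injOn hq hq1 this

include h

/-- The second family of nodes is empty here, and (u;q)_(i+L)/(u;q)_i is a polynomial of degree at
most L in q^i. What remains is a sum over j + 1 nodes with numerator of degree at most s + L. -/
theorem sumA_eq_zero {s L j : ℕ} (hs : s + L < j) : sumA q u s j (-1 - L) = 0 := by
  have hdeg : (X ^ s * ∏ l ∈ range L, (1 - C (u * q ^ l) * X) : ℂ[X]).natDegree ≤ s + L := by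
    refine natDegree_mul_le.trans (add_le_add (natDegree_X_pow_le s) ?_)
    refine (natDegree_prod_le _ _).trans ((sum_le_card_nsmul _ _ 1 fun l _ => ?_).trans (by simp))
    compute_degree
  rw [sumA, ← sum_eval_div_prod_eq_zero (natPow_injOn hq hq1 (range (j + 1) : Finset ℕ))
    (p := X ^ s * ∏ l ∈ range L, (1 - C (u * q ^ l) * X)) (by rw [card_range]; omega)]
  refine sum_congr rfl fun i hi => ?_
  have hi : i ≤ j := by simpa [Nat.lt_succ_iff] using hi
  rw [prod_erase_pow_sub_pow q hi, show (i : ℤ) - 1 - (-1 - L) = i + L by ring,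
    qPoch_add_natCast hq h, eval_mul, eval_prod, neg_one_pow_div]
  have h1 := h.qPoch_ne_zero hq i
  rw [show (s : ℤ) * i - tri i - i * (j - i) = ((s * i : ℕ) : ℤ) - (tri i + i * (j - i)) by
    push_cast; ring, zpow_sub₀ hq, zpow_natCast]
  have h3 : ∏ l ∈ range L, (1 - C (u * q ^ l) * X : ℂ[X]).eval (q ^ i) = poch (u * q ^ (i : ℤ)) q L := by
    refine prod_congr rfl fun l _ => ?_
    simp
    ring
  rw [h3, eval_pow, eval_X, ← pow_mul, mul_comm i s]
  field_simp

/-- The mirror case, with the first family empty. The factor q^(lL) coming from -(j+1)l turns the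
factorial quotient into a polynomial in q^l. -/
theorem sumB_eq_zero {s L b : ℕ} (hs : s + L < b) : sumB q u s (-1 - L) b = 0 := by
  have hdeg : (X ^ s * ∏ l ∈ range L, (X - C (u * q ^ (-1 - L + l : ℤ))) : ℂ[X]).natDegree
      ≤ s + L := by
    refine natDegree_mul_le.trans (add_le_add (natDegree_X_pow_le s) ?_)
    refine (natDegree_prod_le _ _).trans ((sum_le_card_nsmul _ _ 1 fun l _ => ?_).trans (by simp))
    compute_degree
  rw [sumB, ← sum_eval_div_prod_eq_zero (natPow_injOn hq hq1 (range (b + 1) : Finset ℕ))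
    (p := X ^ s * ∏ l ∈ range L, (X - C (u * q ^ (-1 - L + l : ℤ)))) (by rw [card_range]; omega)]
  refine sum_congr rfl fun i hi => ?_
  have hi : i ≤ b := by simpa [Nat.lt_succ_iff] using hi
  rw [prod_erase_pow_sub_pow q hi, show (-1 - i : ℤ) = (-1 - L - i) + L by ring,
    qPoch_add_natCast hq h, eval_mul, eval_prod, neg_one_pow_div]
  have h1 := h.qPoch_ne_zero hq (-1 - L - i)
  rw [show (s : ℤ) * i - (-1 - L + 1) * i - tri i - i * (b - i)
      = ((i * s : ℕ) : ℤ) + (((i * L : ℕ) : ℤ)) - (tri i + i * (b - i)) by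
    push_cast; ring, zpow_sub₀ hq, zpow_add₀ hq, zpow_natCast, zpow_natCast]
  have h3 : ∏ l ∈ range L, (X - C (u * q ^ (-1 - L + l : ℤ)) : ℂ[X]).eval (q ^ i)
      = q ^ (i * L) * poch (u * q ^ (-1 - L - i : ℤ)) q L := by
    rw [poch, pow_mul, ← card_range L, ← prod_const, card_range, ← prod_mul_distrib]
    refine prod_congr rfl fun l _ => ?_
    rw [eval_sub, eval_X, eval_C, mul_sub, mul_one, sub_right_inj, ← zpow_natCast q l,
      ← zpow_natCast q i, mul_assoc, mul_left_comm, ← zpow_add₀ hq, ← zpow_add₀ hq]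
    congr 2
    ring
  rw [h3, eval_pow, eval_X, ← pow_mul]
  field_simp

/-- Partial fractions for X^s over both families at once: there are j + b + 2 nodes, so the two
partial sums add up to zero. -/
theorem sumA_eq_sumB (hu : u ≠ 0) {s j b : ℕ} (hs : s ≤ j + b) :
    sumA q u s j b = (-1) ^ b * (q / u) ^ ((s : ℤ) - j) * q ^ tri (b + 1) * sumB q u s j b := by
  have hqu : q / u ≠ 0 := div_ne_zero hq hu
  let v : ℕ ⊕ ℕ → ℂ := Sum.elim (fun i => q ^ i) (fun l => q / u * q ^ l)
  have hv : Set.InjOn v ((range (j + 1)).disjSum (range (b + 1)) : Finset (ℕ ⊕ ℕ)) := by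
    -- A coincidence between the families would make u an integral power of q.
    have hne : ∀ i l : ℕ, q ^ i ≠ q / u * q ^ l := fun i l hil => by
      refine h (i - 1 - l) ?_
      rw [zpow_sub₀ hq, zpow_sub₀ hq, zpow_natCast, hil, zpow_natCast, zpow_one]
      field_simp
    rintro (i | i) - (l | l) - hil
    · exact congrArg _ (natPow_injOn hq hq1 Set.univ trivial trivial hil)
    · exact absurd hil (hne i l)
    · exact absurd hil.symm (hne l i)
    · exact congrArg _ (natPow_injOn hq hq1 Set.univ trivial trivial (mul_left_cancel₀ hqu hil))
  have key := sum_eval_div_prod_eq_zero hv (p := X ^ s) (by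
    rw [natDegree_X_pow, card_disjSum, card_range, card_range]; omega)
  rw [sum_disjSum] at key
  have e1 : ∀ i, ((range (j + 1)).disjSum (range (b + 1))).erase (Sum.inl i)
      = ((range (j + 1)).erase i).disjSum (range (b + 1)) := fun i => by
    ext (x | x) <;> simp
  have e2 : ∀ i, ((range (j + 1)).disjSum (range (b + 1))).erase (Sum.inr i)
      = (range (j + 1)).disjSum ((range (b + 1)).erase i) := fun i => by
    ext (x | x) <;> simp
  have s1 : ∑ i ∈ range (j + 1), (X ^ s : ℂ[X]).eval (v (Sum.inl i))
        / ∏ k ∈ ((range (j + 1)).disjSum (range (b + 1))).erase (Sum.inl i), (v (Sum.inl i) - v k)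
      = ((-1) ^ (b + 1) * (q / u) ^ (-(b : ℤ) - 1) * q ^ (- tri (b + 1))) * sumA q u s j b := by
    rw [sumA, mul_sum]
    refine sum_congr rfl fun i hi => ?_
    have hi : i ≤ j := by simpa [Nat.lt_succ_iff] using hi
    rw [e1, prod_disjSum]
    simp only [v, Sum.elim_inl, Sum.elim_inr]
    rw [prod_pow_sub_node hq h hu, prod_erase_pow_sub_pow q hi, eval_pow, eval_X]
    have h1 := h.qPoch_ne_zero hq i
    have h2 : q ^ (tri i + i * (j - i) : ℤ) ≠ 0 := zpow_ne_zero _ hq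
    have h3 := h.qPoch_ne_zero hq (i - 1 - b)
    rw [show (s : ℤ) * i - tri i - i * (j - i) = ((i * s : ℕ) : ℤ) - (tri i + i * (j - i)) by
      push_cast; ring, zpow_sub₀ hq, zpow_natCast, pow_mul, zpow_neg,
      show -(b : ℤ) - 1 = -((b : ℤ) + 1) by ring, zpow_neg, mul_mul_mul_comm, mul_assoc ((-1) ^ i) ((-1) ^ (b + 1)),
      neg_one_pow_div, neg_one_pow_div]
    field_simp
  have s2 : ∑ i ∈ range (b + 1), (X ^ s : ℂ[X]).eval (v (Sum.inr i))
        / ∏ k ∈ ((range (j + 1)).disjSum (range (b + 1))).erase (Sum.inr i), (v (Sum.inr i) - v k)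
      = (q / u) ^ ((s : ℤ) - b - j - 1) * sumB q u s j b := by
    rw [sumB, mul_sum]
    refine sum_congr rfl fun i hi => ?_
    have hi : i ≤ b := by simpa [Nat.lt_succ_iff] using hi
    rw [e2, prod_disjSum]
    simp only [v, Sum.elim_inl, Sum.elim_inr]
    have h5 : ∏ k ∈ (range (b + 1)).erase i, (q / u * q ^ i - q / u * q ^ k)
        = (q / u) ^ b * ∏ k ∈ (range (b + 1)).erase i, (q ^ i - q ^ k) := by
      rw [prod_congr rfl fun k _ => (mul_sub (q / u) (q ^ i) (q ^ k)).symm, prod_mul_distrib,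
        prod_const, card_erase_of_mem (by simpa [Nat.lt_succ_iff] using hi), card_range,
        Nat.add_sub_cancel]
    rw [prod_node_sub_pow hq h hu, h5, prod_erase_pow_sub_pow q hi, eval_pow, eval_X]
    rw [show (s : ℤ) * i - (j + 1) * i - tri i - i * (b - i)
        = ((i * s : ℕ) : ℤ) - ((i : ℤ) * ((j : ℤ) + 1)) - (tri i + i * (b - i)) by
      push_cast; ring, zpow_sub₀ hq, zpow_sub₀ hq, zpow_natCast, pow_mul,
      show (s : ℤ) - b - j - 1 = (s : ℤ) - (((j : ℤ) + 1) + b) by ring, zpow_sub₀ hqu, zpow_add₀ hqu,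
      mul_left_comm _ ((-1) ^ i), mul_left_comm _ ((-1) ^ i), neg_one_pow_div, mul_zpow, mul_pow,
      zpow_natCast, zpow_natCast, zpow_mul, zpow_natCast]
    have h6 : (q ^ i) ^ ((j : ℤ) + 1) ≠ 0 := zpow_ne_zero _ (pow_ne_zero _ hq)
    generalize q / u = w at *
    generalize q ^ i = y at *
    field_simp
  rw [s1, s2] at key
  rw [zpow_neg, show -(b : ℤ) - 1 = -((b : ℤ) + 1) by ring, zpow_neg,
    show (s : ℤ) - b - j - 1 = (s - j) - ((b : ℤ) + 1) by ring, zpow_sub₀ hqu, pow_succ] at key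
  generalize q / u = w at *
  field_simp at key
  have h10 : ((-1) ^ b * (-1) ^ b : ℂ) = 1 := by rw [← mul_pow]; simp
  linear_combination (-(-1) ^ b) * key + (-sumA q u s j b) * h10

end

end

/-! ### The coefficients as partial fraction sums -/

section

open Finset

theorem poch_zpow_neg {q : ℂ} (hq : q ≠ 0) {i j : ℕ} (hij : i ≤ j) :
    poch (q ^ (-(j : ℤ))) q i * poch q q (j - i) = (-1) ^ i * q ^ (tri i - i * j) * poch q q j := by
  induction i with
  | zero => simp
  | succ i ih =>
    have h1 : poch q q (j - i) = poch q q (j - (i + 1)) * (1 - q ^ ((j : ℤ) - i)) := by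
      rw [show j - i = j - (i + 1) + 1 by omega, poch_succ, ← zpow_natCast,
        ← zpow_one_add₀ hq]
      push_cast [hij]
      congr 3
      ring
    have h2 : q ^ ((j : ℤ) - i) ≠ 0 := zpow_ne_zero _ hq
    have h3 : (q ^ (-(j : ℤ)) * q ^ i) = (q ^ ((j : ℤ) - i))⁻¹ := by
      rw [← zpow_natCast, ← zpow_add₀ hq, ← zpow_neg]; congr 1; ring
    have h4 : q ^ (tri ((i + 1 : ℕ) : ℤ) - ((i + 1 : ℕ) : ℤ) * j)
        = q ^ (tri i - i * j) * (q ^ ((j : ℤ) - i))⁻¹ := by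
      rw [← zpow_neg, ← zpow_add₀ hq]
      push_cast
      rw [tri_add, tri_one]
      congr 1
      ring
    rw [poch_succ, h3, h4, pow_succ]
    have h5 := ih (by omega)
    rw [h1] at h5
    generalize q ^ ((j : ℤ) - i) = t at *
    field_simp
    linear_combination (-1 : ℂ) * h5

/-- The coefficients `a_j`, with the exponents of `q`, `q ^ ν` and the argument as parameters. -/
noncomputable def termA (q u : ℂ) (M x y t : ℤ) (j : ℕ) : ℂ :=
  qPoch u q M / (poch q q j * qPoch (q ^ (2 : ℤ) / u) q (j - M)) * (q ^ x * u ^ y)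
    * ∑ i ∈ range (j + 1), poch (q ^ (-(j : ℤ))) q i * poch (u * q ^ (M - j - 1)) q i
      / (poch q q i * poch u q i) * (q ^ t) ^ i

/-- The coefficients `b_j`, with the exponents of `q`, `q ^ ν` and the argument as parameters. -/
noncomputable def termB (q u : ℂ) (M x y t : ℤ) (j : ℕ) : ℂ :=
  1 / (poch q q j * qPoch (q ^ (2 : ℤ) / u) q j) * (q ^ x * u ^ y)
    * ∑ i ∈ range (j + 1), poch (q ^ (-(j : ℤ))) q i * poch (u * q ^ (-(j : ℤ) - 1)) q i
      / (poch q q i * poch (u * q ^ M) q i) * (q ^ t) ^ i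

theorem neg_one_zpow_ne_zero (k : ℤ) : (-1 : ℂ) ^ k ≠ 0 := zpow_ne_zero _ (by norm_num)

section

variable {q u : ℂ} (hq : q ≠ 0) (hq1 : ∀ k : ℕ, poch q q k ≠ 0) (hu : u ≠ 0) (h : Generic q u)

include hq hq1 hu h

/-- Reversal with N = -1 rewrites (q²/u;q)_(j-M) through factorials of u. The one of index M-j-1
merges with (u q^(M-j-1);q)_i into the numerator of `sumA`, and the 1 in s + 1 is absorbed by i² = 2
tri i + i. -/
theorem termA_eq (M x y s : ℤ) (j : ℕ) :
    termA q u M x y (s + 1) j = qPoch u q M / qPoch u q (-1) * (-1) ^ (j - M) * u ^ (j - M + y)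
      * q ^ (x - 2 * (j - M) - tri (j - M)) * sumA q u s j (j - M) := by
  have hb := qPoch_zpow_div hq hu h (-1) (j - M)
  rw [show (1 : ℤ) - -1 = 2 by norm_num] at hb
  have hb' := h.qPoch_ne_zero hq (-1 - (j - M))
  have hm := h.qPoch_ne_zero hq (-1)
  have hsum : ∑ i ∈ range (j + 1), poch (q ^ (-(j : ℤ))) q i * poch (u * q ^ (M - j - 1)) q i
      / (poch q q i * poch u q i) * (q ^ (s + 1)) ^ i
      = poch q q j / qPoch u q (-1 - (j - M)) * sumA q u s j (j - M) := by
    rw [sumA, mul_sum]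
    refine sum_congr rfl fun i hi => ?_
    have hi : i ≤ j := by simpa [Nat.lt_succ_iff] using hi
    have h1 := poch_zpow_neg hq hi
    have h2 := qPoch_add_natCast hq h (-1 - (j - M)) i
    rw [show -1 - ((j : ℤ) - M) + i = i - 1 - (j - M) by ring,
      show -1 - ((j : ℤ) - M) = M - j - 1 by ring] at h2
    have h3 : q ^ (tri i - i * j : ℤ) * (q ^ (s + 1)) ^ i
        = q ^ (s * i - tri i - i * (j - i) : ℤ) := by
      rw [← zpow_natCast, ← zpow_mul, ← zpow_add₀ hq]
      congr 1
      have := two_mul_tri i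
      linear_combination this
    have h4 := hq1 (j - i)
    rw [eq_div_iff_mul_eq h4 |>.2 h1, h2, ← h3, qPoch_natCast,
      show -1 - ((j : ℤ) - M) = M - j - 1 by ring] at *
    field_simp
  rw [termA, hsum, hb]
  have h7 := hq1 j
  rw [zpow_add₀ hu, zpow_sub₀ hq, zpow_sub₀ hq, zpow_add₀ hq, zpow_neg,
    show (2 : ℤ) * (j - M) = (1 - -1) * (j - M) by ring]
  have h8 : (-1 : ℂ) ^ (j - M : ℤ) * (-1) ^ (j - M : ℤ) = 1 := by
    rw [← mul_zpow]; simp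
  have h9 := neg_one_zpow_ne_zero (j - M)
  generalize (-1 : ℂ) ^ (j - M : ℤ) = e at *
  field_simp
  linear_combination (-qPoch u q M * sumA q u s j (j - M)) * h8

/-- Here the summation order is reversed, l = b - i. The exponent of the argument is parametrised so
that the reversed sum carries q^(s l). -/
theorem termB_eq (M x y s : ℤ) (b : ℕ) :
    termB q u M x y (M + b + b + 1 - s) b = qPoch u q M / qPoch u q (-1) * u ^ (b + y)
      * q ^ (x - 2 * b - b * b + (M + b + b + 1 - s) * b) * sumB q u s (M + b) b := by
  have hb := qPoch_zpow_div hq hu h (-1) b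
  rw [show (1 : ℤ) - -1 = 2 by norm_num] at hb
  have hb' := h.qPoch_ne_zero hq (-1 - b)
  have hM := h.qPoch_ne_zero hq M
  have hsum : ∑ i ∈ range (b + 1), poch (q ^ (-(b : ℤ))) q i * poch (u * q ^ (-(b : ℤ) - 1)) q i
      / (poch q q i * poch (u * q ^ M) q i) * (q ^ (M + b + b + 1 - s)) ^ i
      = (-1) ^ b * q ^ (tri b - b * b + (M + b + b + 1 - s) * b) * qPoch u q M
        * (poch q q b / qPoch u q (-1 - b)) * sumB q u s (M + b) b := by
    rw [sumB, mul_sum, ← sum_range_reflect]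
    refine sum_congr rfl fun l hl => ?_
    have hl : l ≤ b := by simpa [Nat.lt_succ_iff] using hl
    have h1 := poch_zpow_neg hq (Nat.sub_le b l)
    rw [Nat.sub_sub_self hl] at h1
    have h2 := qPoch_add_natCast hq h (-1 - b) (b - l)
    have h2' := qPoch_add_natCast hq h M (b - l)
    push_cast [hl] at h2 h2' h1
    rw [show -1 - (b : ℤ) + (b - l) = -1 - l by ring,
      show -1 - (b : ℤ) = -b - 1 by ring] at h2
    rw [show M + ((b : ℤ) - l) = M + b - l by ring] at h2'
    have h3 : q ^ (tri (b - l) - (b - l) * b : ℤ) * (q ^ (M + b + b + 1 - s)) ^ (b - l)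
        = q ^ (tri b - b * b + (M + b + b + 1 - s) * b) *
          q ^ (s * l - (M + b + 1) * l - tri l - l * (b - l) : ℤ) := by
      rw [← zpow_natCast, ← zpow_mul, ← zpow_add₀ hq, ← zpow_add₀ hq, tri_sub]
      push_cast [hl]
      congr 1
      have := two_mul_tri l
      linear_combination this
    have h4 := hq1 l
    have h8 : (-1 : ℂ) ^ (b - l) = (-1) ^ b * (-1) ^ l := by
      rw [← Nat.sub_add_cancel hl, pow_add, Nat.add_sub_cancel, mul_assoc, ← mul_pow]; simp
    rw [show b + 1 - 1 - l = b - l by omega, eq_div_iff_mul_eq h4 |>.2 h1, h2, h2', h8,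
      show -1 - (b : ℤ) = -b - 1 by ring] at *
    have h9 : ∀ a b c d e f g i : ℂ, a * b * c / d * e / (f * g) * i
      = a * (b * i) * c / d * e / (f * g) := fun a b c d e f g i => by ring
    rw [h9, h3]
    field_simp
  rw [termB, hsum, hb]
  have h7 := hq1 b
  have e1 : q ^ (x - 2 * b - b * b + (M + b + b + 1 - s) * b : ℤ)
      = q ^ x * q ^ (tri b - b * b + (M + b + b + 1 - s) * b) / q ^ (2 * b + tri b : ℤ) := by
    rw [← zpow_add₀ hq, ← zpow_sub₀ hq]; congr 1; ring
  rw [e1, zpow_add₀ hu, zpow_neg, zpow_natCast (-1)]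
  norm_num
  generalize q ^ (2 * b + tri b : ℤ) = e at *
  generalize q ^ (tri b - b * b + (M + b + b + 1 - s) * b) = e' at *
  field_simp

end

end

/-! ### Vanishing of the high coefficients -/

section

open Finset

/-- The coefficients `a_j` as functions of `u = q ^ ν`. -/
noncomputable def cA (q u : ℂ) (M n j : ℤ) : ℂ :=
  if 0 ≤ j then
    if 0 ≤ n then termA q u M ((j - M + 1) * n) (-(j - M + n)) (2 * j - M - n + 1) j.toNat
    else termA q u M ((j - M + 1) * (j + n)) (-(2 * j - M + n)) (1 - n) j.toNat
  else 0

/-- The coefficients `b_j` as functions of `u = q ^ ν`. -/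
noncomputable def cB (q u : ℂ) (M n j : ℤ) : ℂ :=
  if 0 ≤ j then
    if 0 ≤ n then termB q u M (j * (j + 1)) (-(2 * j)) (n + 1) j.toNat
    else termB q u M 0 (-j) (2 * j + M + n + 1) j.toNat
  else 0

theorem poch_self_ne_zero {q : ℂ} (hq1 : ∀ k : ℤ, k ≠ 0 → q ^ k ≠ 1) (k : ℕ) :
    poch q q k ≠ 0 :=
  poch_ne_zero fun i _ => by
    have := hq1 (i + 1) (by omega)
    rw [← pow_succ']
    exact_mod_cast this

section

variable {q u : ℂ} (hq : q ≠ 0) (hq1 : ∀ k : ℤ, k ≠ 0 → q ^ k ≠ 1) (hu : u ≠ 0) (h : Generic q u)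

include hq hq1 hu h

theorem cA_of_nonneg {M n : ℤ} (hn : 0 ≤ n) (j : ℕ) :
    cA q u M n j = qPoch u q M / qPoch u q (-1) * (-1) ^ (j - M) * u ^ (-n)
      * q ^ ((j - M + 1) * n - 2 * (j - M) - tri (j - M)) * sumA q u (2 * j - M - n) j (j - M) := by
  rw [cA, if_pos (Int.natCast_nonneg j), if_pos hn, Int.toNat_natCast,
    termA_eq hq (poch_self_ne_zero hq1) hu h]
  congr 4
  ring

theorem cA_of_neg {M n : ℤ} (hn : ¬ 0 ≤ n) (j : ℕ) :
    cA q u M n j = qPoch u q M / qPoch u q (-1) * (-1) ^ (j - M) * u ^ (-j - n)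
      * q ^ ((j - M + 1) * (j + n) - 2 * (j - M) - tri (j - M)) * sumA q u (-n) j (j - M) := by
  rw [cA, if_pos (Int.natCast_nonneg j), if_neg hn, Int.toNat_natCast,
    show 1 - n = -n + 1 by ring, termA_eq hq (poch_self_ne_zero hq1) hu h]
  congr 4
  ring

theorem cB_of_nonneg {M n : ℤ} (hn : 0 ≤ n) (b : ℕ) :
    cB q u M n b = qPoch u q M / qPoch u q (-1) * u ^ (-b : ℤ) * q ^ (n * b)
      * sumB q u (M + b + b - n) (M + b) b := by
  rw [cB, if_pos (Int.natCast_nonneg b), if_pos hn, Int.toNat_natCast,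
    show n + 1 = M + b + b + 1 - (M + b + b - n) by ring,
    termB_eq hq (poch_self_ne_zero hq1) hu h]
  congr 3 <;> [congr 1; skip] <;> ring

theorem cB_of_neg {M n : ℤ} (hn : ¬ 0 ≤ n) (b : ℕ) :
    cB q u M n b = qPoch u q M / qPoch u q (-1) * q ^ ((M + b + n - 1) * b)
      * sumB q u (-n) (M + b) b := by
  rw [cB, if_pos (Int.natCast_nonneg b), if_neg hn, Int.toNat_natCast,
    show 2 * b + M + n + 1 = M + b + b + 1 - (-n) by ring,
    termB_eq hq (poch_self_ne_zero hq1) hu h, add_neg_cancel, zpow_zero, mul_one]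
  congr 3
  ring

/-- The numerator is X^s with s = 2j-M-n for n ≥ 0 and s = -n for n < 0. In the first case the bound
on j says s ≥ 0, in the second it says s ≤ j + b. If j or b is negative, one side is zero by
convention and the other is a sum with an empty node family. -/
theorem cA_eq_cB {M n j b : ℤ} (hjb : b = j - M)
    (h1 : 0 ≤ n → M + n ≤ 2 * j) (h2 : n < 0 → M - n ≤ 2 * j) : cA q u M n j = cB q u M n b := by
  obtain ⟨s, hs⟩ : ∃ s : ℕ, (s : ℤ) = if 0 ≤ n then 2 * j - M - n else -n :=
    Int.eq_ofNat_of_zero_le (by split_ifs <;> omega) |>.imp fun _ => Eq.symm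
  rcases lt_or_ge j 0 with hj | hj
  · lift b to ℕ using by omega
    obtain ⟨L, hL⟩ : ∃ L : ℕ, M + b = -1 - L := ⟨(-1 - (M + b)).toNat, by omega⟩
    rw [cA, if_neg (by omega)]
    split_ifs at hs with hn
    · rw [cB_of_nonneg hq hq1 hu h hn, show M + b + b - n = s by omega, hL,
        sumB_eq_zero hq hq1 h (by omega), mul_zero]
    · rw [cB_of_neg hq hq1 hu h hn, ← hs, hL, sumB_eq_zero hq hq1 h (by omega), mul_zero]
  · lift j to ℕ using hj
    rcases lt_or_ge b 0 with hb | hb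
    · obtain ⟨L, hL⟩ : ∃ L : ℕ, (j : ℤ) - M = -1 - L := ⟨(-1 - b).toNat, by omega⟩
      rw [cB, if_neg (by omega)]
      split_ifs at hs with hn
      · rw [cA_of_nonneg hq hq1 hu h hn, ← hs, hL, sumA_eq_zero hq hq1 h (by omega), mul_zero]
      · rw [cA_of_neg hq hq1 hu h hn, ← hs, hL, sumA_eq_zero hq hq1 h (by omega), mul_zero]
    · lift b to ℕ using hb
      have hM : M = j - b := by omega
      subst hM
      have hsgn : (-1 : ℂ) ^ (b : ℕ) * (-1) ^ (b : ℕ) = 1 := by rw [← mul_pow]; simp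
      split_ifs at hs with hn
      · rw [cA_of_nonneg hq hq1 hu h hn, cB_of_nonneg hq hq1 hu h hn, ← hs,
          show (j : ℤ) - (j - b) = b by ring, sumA_eq_sumB hq hq1 h hu (by omega),
          show (j : ℤ) - b + b = j by ring, show (j : ℤ) + b - n = s by omega,
          show (s : ℤ) - j = b - n by omega, zpow_natCast (-1), div_zpow, zpow_sub₀ hu]
        have e : q ^ ((b + 1) * n - 2 * b - tri b) * q ^ (b - n) * q ^ tri (b + 1) = q ^ (n * b) := by
          rw [← zpow_add₀ hq, ← zpow_add₀ hq, tri_add, tri_one]; congr 1; ring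
        rw [← e, zpow_neg, zpow_neg]
        generalize (-1 : ℂ) ^ b = e at *
        field_simp
        rw [show e ^ 2 = 1 by rw [sq, hsgn]]
        ring
      · rw [cA_of_neg hq hq1 hu h hn, cB_of_neg hq hq1 hu h hn, ← hs,
          show (j : ℤ) - (j - b) = b by ring, sumA_eq_sumB hq hq1 h hu (by omega),
          show (j : ℤ) - b + b = j by ring, show n = -s by omega,
          zpow_natCast (-1), div_zpow, show -(j : ℤ) - -s = s - j by ring]
        have e : q ^ ((b + 1) * (j + -s) - 2 * b - tri b) * q ^ (s - j : ℤ) * q ^ tri (b + 1)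
            = q ^ ((j + -s - 1) * b : ℤ) := by
          rw [← zpow_add₀ hq, ← zpow_add₀ hq, tri_add, tri_one]; congr 1; ring
        rw [← e]
        generalize (-1 : ℂ) ^ b = e at *
        field_simp
        rw [show e ^ 2 = 1 by rw [sq, hsgn]]
        ring

theorem cA_eq_cB_of_g_lt {M n : ℤ} {k : ℕ} (hk : g M n < k) :
    cA q u M n (k + min M 0) = cB q u M n (k - max M 0) := by
  -- The minimum in `g` is `min M 0` for n ≥ 0 and `n + min M 0` for n < 0; either way k > `g M n`
  -- says 2j ≥ M + |n| for j = k + `min M 0`.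
  unfold g at hk
  exact cA_eq_cB hq hq1 hu h (by omega) (by omega) (by omega)

end

end

/-! ### Products of the `q`-Bessel series -/

section

open Finset

/-- The power series `₂φ₁(0, 0; c; q, -z)`, which belongs to Jackson's first `q`-Bessel function. -/
noncomputable def ser1 (q c : ℂ) : PowerSeries ℂ :=
  PowerSeries.mk fun k => (-1) ^ k / (poch q q k * poch c q k)

/-- The power series `₀φ₁(-; c; q, -c z)`, which belongs to Jackson's second `q`-Bessel function. -/
noncomputable def ser2 (q c : ℂ) : PowerSeries ℂ :=
  PowerSeries.mk fun k => (-1) ^ k * (q ^ tri k) ^ 2 * c ^ k / (poch q q k * poch c q k)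

theorem coeff_mul_rescale (f g : PowerSeries ℂ) (a : ℂ) (j : ℕ) :
    PowerSeries.coeff j (f * PowerSeries.rescale a g)
      = ∑ i ∈ range (j + 1), PowerSeries.coeff i f * (a ^ (j - i) * PowerSeries.coeff (j - i) g) := by
  rw [PowerSeries.coeff_mul, Nat.sum_antidiagonal_eq_sum_range_succ_mk]
  simp [PowerSeries.coeff_rescale]

theorem neg_one_pow_sub {i j : ℕ} (hij : i ≤ j) : (-1 : ℂ) ^ (j - i) = (-1) ^ j * (-1) ^ i := by
  rw [← Nat.sub_add_cancel hij, pow_add, Nat.add_sub_cancel, mul_assoc, ← mul_pow]; simp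

theorem poch_mul_zpow {q u : ℂ} (hq : q ≠ 0) (h : Generic q u) (M : ℤ) (k : ℕ) :
    poch (u * q ^ M) q k = qPoch u q (M + k) / qPoch u q M := by
  rw [qPoch_add_natCast hq h, mul_div_cancel_left₀ _ (h.qPoch_ne_zero hq M)]

section

variable {q u : ℂ} (hq : q ≠ 0) (hq1 : ∀ k : ℤ, k ≠ 0 → q ^ k ≠ 1) (hu : u ≠ 0) (h : Generic q u)

include hq hu h

theorem poch_zpow_two_sub_div (M : ℤ) (k : ℕ) :
    poch (q ^ (2 - M) / u) q k = (-1) ^ k * (q ^ ((2 - M) * k + tri k) / u ^ k)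
      * qPoch u q (M - 1) / qPoch u q (M - 1 - k) := by
  have := qPoch_zpow_div hq hu h (M - 1) k
  rw [show 1 - (M - 1) = 2 - M by ring, qPoch_natCast, zpow_neg, zpow_natCast, zpow_natCast] at this
  rw [this]
  ring

include hq1

/-- In the Cauchy product, reversing (q^(2-M)/u;q)_(j-i) moves (u;q)_(i-1-(j-M)) into the numerator,
so the convolution is already the partial fraction sum. The three lemmas that follow use the same
mechanism. -/
theorem coeff_ser2_mul_ser1 (M n : ℤ) (j : ℕ) :
    PowerSeries.coeff j (ser2 q u * PowerSeries.rescale (q ^ n) (ser1 q (q ^ (2 - M) / u)))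
      = u ^ j * q ^ ((n + M - 2) * j - tri j) / qPoch u q (M - 1)
        * sumA q u (2 * j - M - n) j (j - M) := by
  rw [coeff_mul_rescale, sumA, mul_sum]
  refine sum_congr rfl fun i hi => ?_
  have hi : i ≤ j := by simpa [Nat.lt_succ_iff] using hi
  have h1 := poch_self_ne_zero hq1 i
  have h2 := poch_self_ne_zero hq1 (j - i)
  have h3 := h.qPoch_ne_zero hq (M - 1)
  have h4 := h.qPoch_ne_zero hq (i - 1 - (j - M))
  have h5 := h.poch_ne_zero i
  have e1 : u ^ j = u ^ i * u ^ (j - i) := by rw [← pow_add]; congr 1; omega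
  have e2 : (q ^ tri i) ^ 2 * (q ^ n) ^ (j - i)
      = q ^ ((n + M - 2) * j - tri j) * q ^ ((2 * j - M - n) * i - tri i - i * (j - i))
        * q ^ ((2 - M) * ((j - i : ℕ) : ℤ) + tri ((j - i : ℕ) : ℤ)) := by
    rw [← zpow_natCast, ← zpow_natCast, ← zpow_mul, ← zpow_mul, ← zpow_add₀ hq, ← zpow_add₀ hq,
      ← zpow_add₀ hq]
    push_cast [hi]
    rw [tri_sub]
    congr 1
    have := two_mul_tri i
    linear_combination this
  have h6 : q ^ ((2 - M) * ((j - i : ℕ) : ℤ) + tri ((j - i : ℕ) : ℤ)) ≠ 0 := zpow_ne_zero _ hq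
  have e3 : M - 1 - ((j - i : ℕ) : ℤ) = i - 1 - (j - M) := by push_cast [hi]; ring
  rw [ser2, ser1, PowerSeries.coeff_mk, PowerSeries.coeff_mk, poch_zpow_two_sub_div hq hu h, e1,
    qPoch_natCast, e3]
  generalize (q ^ ((2 - M) * ((j - i : ℕ) : ℤ) + tri ((j - i : ℕ) : ℤ))) = w at *
  have h7 : (-1 : ℂ) ^ (j - i) ≠ 0 := pow_ne_zero _ (by norm_num)
  have e4 : (-1) ^ i * (q ^ tri i) ^ 2 * u ^ i / (poch q q i * poch u q i) *
      ((q ^ n) ^ (j - i) * ((-1) ^ (j - i) / (poch q q (j - i) *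
      ((-1) ^ (j - i) * (w / u ^ (j - i)) * qPoch u q (M - 1) / qPoch u q (i - 1 - (j - M))))))
      = ((q ^ tri i) ^ 2 * (q ^ n) ^ (j - i)) * (u ^ i * u ^ (j - i)) * (-1) ^ i
       / (poch q q i * poch u q i * poch q q (j - i) * w * qPoch u q (M - 1))
        * qPoch u q (i - 1 - (j - M)) := by
    field_simp
  rw [e4, e2]
  field_simp

theorem coeff_ser1_mul_ser2 (M n : ℤ) (j : ℕ) :
    PowerSeries.coeff j (ser1 q u * PowerSeries.rescale (q ^ n) (ser2 q (q ^ (2 - M) / u)))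
      = q ^ (tri j + n * j) / qPoch u q (M - 1) * sumA q u (-n) j (j - M) := by
  rw [coeff_mul_rescale, sumA, mul_sum]
  refine sum_congr rfl fun i hi => ?_
  have hi : i ≤ j := by simpa [Nat.lt_succ_iff] using hi
  have h1 := poch_self_ne_zero hq1 i
  have h2 := poch_self_ne_zero hq1 (j - i)
  have h3 := h.qPoch_ne_zero hq (M - 1)
  have h4 := h.qPoch_ne_zero hq (i - 1 - (j - M))
  have h5 := h.poch_ne_zero i
  have e2 : (q ^ tri ((j - i : ℕ) : ℤ)) ^ 2 * (q ^ n) ^ (j - i) * (q ^ (2 - M)) ^ (j - i)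
      = q ^ (tri j + n * j) * q ^ (-n * i - tri i - i * (j - i))
        * q ^ ((2 - M) * ((j - i : ℕ) : ℤ) + tri ((j - i : ℕ) : ℤ)) := by
    rw [← zpow_natCast, ← zpow_natCast, ← zpow_natCast (q ^ (2 - M)), ← zpow_mul, ← zpow_mul,
      ← zpow_mul, ← zpow_add₀ hq, ← zpow_add₀ hq, ← zpow_add₀ hq, ← zpow_add₀ hq]
    push_cast [hi]
    rw [tri_sub]
    congr 1
    have := two_mul_tri i
    linear_combination this
  have h6 : q ^ ((2 - M) * ((j - i : ℕ) : ℤ) + tri ((j - i : ℕ) : ℤ)) ≠ 0 := zpow_ne_zero _ hq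
  have e3 : M - 1 - ((j - i : ℕ) : ℤ) = i - 1 - (j - M) := by push_cast [hi]; ring
  rw [ser2, ser1, PowerSeries.coeff_mk, PowerSeries.coeff_mk, poch_zpow_two_sub_div hq hu h,
    qPoch_natCast, e3, div_pow]
  generalize (q ^ ((2 - M) * ((j - i : ℕ) : ℤ) + tri ((j - i : ℕ) : ℤ))) = w at *
  have h7 : (-1 : ℂ) ^ (j - i) ≠ 0 := pow_ne_zero _ (by norm_num)
  have e4 : (-1) ^ i / (poch q q i * poch u q i) * ((q ^ n) ^ (j - i) * ((-1) ^ (j - i)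
      * (q ^ tri ((j - i : ℕ) : ℤ)) ^ 2 * ((q ^ (2 - M)) ^ (j - i) / u ^ (j - i)) / (poch q q (j - i) *
      ((-1) ^ (j - i) * (w / u ^ (j - i)) * qPoch u q (M - 1) / qPoch u q (i - 1 - (j - M))))))
      = ((q ^ tri ((j - i : ℕ) : ℤ)) ^ 2 * (q ^ n) ^ (j - i) * (q ^ (2 - M)) ^ (j - i)) * (-1) ^ i
       / (poch q q i * poch u q i * poch q q (j - i) * w * qPoch u q (M - 1))
        * qPoch u q (i - 1 - (j - M)) := by
    field_simp
  rw [e4, e2]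
  field_simp

theorem coeff_ser2_mul_ser1' (M n : ℤ) (b : ℕ) :
    PowerSeries.coeff b (ser2 q (q ^ (2 : ℤ) / u) * PowerSeries.rescale (q ^ n) (ser1 q (u * q ^ M)))
      = (-1) ^ b * q ^ (n * b) * qPoch u q M / qPoch u q (-1)
        * sumB q u (M + b + b - n) (M + b) b := by
  rw [coeff_mul_rescale, sumB, mul_sum]
  refine sum_congr rfl fun l hl => ?_
  have hl : l ≤ b := by simpa [Nat.lt_succ_iff] using hl
  have h1 := poch_self_ne_zero hq1 l
  have h2 := poch_self_ne_zero hq1 (b - l)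
  have h3 := h.qPoch_ne_zero hq (-1)
  have h4 := h.qPoch_ne_zero hq (-1 - l)
  have h5 := h.qPoch_ne_zero hq (M + b - l)
  have h8 := h.qPoch_ne_zero hq M
  have hr := poch_zpow_two_sub_div hq hu h 0 l
  rw [sub_zero, zero_sub] at hr
  have e2 : (q ^ tri l) ^ 2 * (q ^ n) ^ (b - l) * (q ^ (2 : ℤ)) ^ l
      = q ^ (n * b) * q ^ ((M + b + b - n) * l - (M + b + 1) * l - tri l - l * (b - l))
        * q ^ (2 * l + tri l) := by
    rw [← zpow_natCast, ← zpow_natCast, ← zpow_natCast (q ^ (2 : ℤ)), ← zpow_mul, ← zpow_mul,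
      ← zpow_mul, ← zpow_add₀ hq, ← zpow_add₀ hq, ← zpow_add₀ hq, ← zpow_add₀ hq]
    push_cast [hl]
    congr 1
    have := two_mul_tri l
    linear_combination this
  have h6 : q ^ (2 * (l : ℤ) + tri l) ≠ 0 := zpow_ne_zero _ hq
  have e3 : M + ((b - l : ℕ) : ℤ) = M + b - l := by push_cast [hl]; ring
  rw [ser2, ser1, PowerSeries.coeff_mk, PowerSeries.coeff_mk, hr, poch_mul_zpow hq h, e3,
    div_pow, neg_one_pow_sub hl]
  generalize q ^ (2 * (l : ℤ) + tri l) = w at *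
  have h7 : (-1 : ℂ) ^ l ≠ 0 := pow_ne_zero _ (by norm_num)
  have e4 : (-1) ^ l * (q ^ tri l) ^ 2 * ((q ^ (2 : ℤ)) ^ l / u ^ l) / (poch q q l *
      ((-1) ^ l * (w / u ^ l) * qPoch u q (-1) / qPoch u q (-1 - l))) * ((q ^ n) ^ (b - l) *
      ((-1) ^ b * (-1) ^ l / (poch q q (b - l) * (qPoch u q (M + b - l) / qPoch u q M))))
      = ((q ^ tri l) ^ 2 * (q ^ n) ^ (b - l) * (q ^ (2 : ℤ)) ^ l) * ((-1) ^ b * (-1) ^ l)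
       * qPoch u q (-1 - l) * qPoch u q M
       / (poch q q l * w * qPoch u q (-1) * poch q q (b - l) * qPoch u q (M + b - l)) := by
    field_simp
  rw [e4, e2]
  field_simp

theorem coeff_ser1_mul_ser2' (M n : ℤ) (b : ℕ) :
    PowerSeries.coeff b (ser1 q (q ^ (2 : ℤ) / u) * PowerSeries.rescale (q ^ n) (ser2 q (u * q ^ M)))
      = (-1) ^ b * u ^ b * q ^ (2 * tri b + (M + n) * b) * qPoch u q M / qPoch u q (-1)
        * sumB q u (-n) (M + b) b := by
  rw [coeff_mul_rescale, sumB, mul_sum]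
  refine sum_congr rfl fun l hl => ?_
  have hl : l ≤ b := by simpa [Nat.lt_succ_iff] using hl
  have h1 := poch_self_ne_zero hq1 l
  have h2 := poch_self_ne_zero hq1 (b - l)
  have h3 := h.qPoch_ne_zero hq (-1)
  have h4 := h.qPoch_ne_zero hq (-1 - l)
  have h5 := h.qPoch_ne_zero hq (M + b - l)
  have h8 := h.qPoch_ne_zero hq M
  have hr := poch_zpow_two_sub_div hq hu h 0 l
  rw [sub_zero, zero_sub] at hr
  have e1 : u ^ b = u ^ l * u ^ (b - l) := by rw [← pow_add]; congr 1; omega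
  have e2 : (q ^ tri ((b - l : ℕ) : ℤ)) ^ 2 * (q ^ n) ^ (b - l) * (q ^ M) ^ (b - l)
      = q ^ (2 * tri b + (M + n) * b) * q ^ (-n * l - (M + b + 1) * l - tri l - l * (b - l))
        * q ^ (2 * l + tri l) := by
    rw [← zpow_natCast, ← zpow_natCast, ← zpow_natCast (q ^ M), ← zpow_mul, ← zpow_mul,
      ← zpow_mul, ← zpow_add₀ hq, ← zpow_add₀ hq, ← zpow_add₀ hq, ← zpow_add₀ hq]
    push_cast [hl]
    rw [tri_sub]
    congr 1
    have := two_mul_tri l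
    linear_combination this
  have h6 : q ^ (2 * (l : ℤ) + tri l) ≠ 0 := zpow_ne_zero _ hq
  have e3 : M + ((b - l : ℕ) : ℤ) = M + b - l := by push_cast [hl]; ring
  rw [ser2, ser1, PowerSeries.coeff_mk, PowerSeries.coeff_mk, hr, poch_mul_zpow hq h, e3,
    mul_pow, neg_one_pow_sub hl, e1]
  generalize q ^ (2 * (l : ℤ) + tri l) = w at *
  have h7 : (-1 : ℂ) ^ l ≠ 0 := pow_ne_zero _ (by norm_num)
  have e4 : (-1) ^ l / (poch q q l *
      ((-1) ^ l * (w / u ^ l) * qPoch u q (-1) / qPoch u q (-1 - l))) * ((q ^ n) ^ (b - l) *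
      ((-1) ^ b * (-1) ^ l * (q ^ tri ((b - l : ℕ) : ℤ)) ^ 2 * (u ^ (b - l) * (q ^ M) ^ (b - l))
        / (poch q q (b - l) * (qPoch u q (M + b - l) / qPoch u q M))))
      = ((q ^ tri ((b - l : ℕ) : ℤ)) ^ 2 * (q ^ n) ^ (b - l) * (q ^ M) ^ (b - l))
       * ((-1) ^ b * (-1) ^ l) * (u ^ l * u ^ (b - l)) * qPoch u q (-1 - l) * qPoch u q M
       / (poch q q l * w * qPoch u q (-1) * poch q q (b - l) * qPoch u q (M + b - l)) := by
    field_simp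
  rw [e4, e2]
  field_simp

end

end

/-! ### The polynomials as combinations of products of series -/

section

open Finset

/-- The power series of `(-z; q)_∞`. -/
noncomputable def serE (q : ℂ) : PowerSeries ℂ := PowerSeries.mk fun k => q ^ tri k / poch q q k

/-- The power series of `(-z; q)_n`. -/
noncomputable def polyE (q : ℂ) (n : ℕ) : PowerSeries ℂ :=
  ∏ i ∈ range n, (1 + PowerSeries.C (q ^ i) * PowerSeries.X)

/-- The functional equation of (-z;q)_∞, checked on Euler's expansion, so that no infinite product
enters. -/
theorem serE_eq_mul_rescale {q : ℂ} (hq : q ≠ 0) (hq1 : ∀ k : ℤ, k ≠ 0 → q ^ k ≠ 1) :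
    serE q = (1 + PowerSeries.X) * PowerSeries.rescale q (serE q) := by
  ext k
  rcases k with _ | k
  · rw [add_mul, one_mul, map_add, PowerSeries.coeff_zero_X_mul, PowerSeries.coeff_rescale]
    simp
  · have h1 := poch_self_ne_zero hq1 k
    have h2 := poch_self_ne_zero hq1 (k + 1)
    rw [add_mul, one_mul, map_add, PowerSeries.coeff_succ_X_mul]
    simp only [PowerSeries.coeff_rescale, serE, PowerSeries.coeff_mk]
    push_cast
    rw [tri_add, tri_one, zpow_add₀ hq, poch_succ] at *
    have h3 := right_ne_zero_of_mul h2
    simp only [add_zero, mul_one, zpow_natCast, pow_succ]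
    generalize q ^ k = y at *
    rw [mul_comm q y] at *
    field_simp
    ring

theorem serE_eq_polyE_mul {q : ℂ} (hq : q ≠ 0) (hq1 : ∀ k : ℤ, k ≠ 0 → q ^ k ≠ 1) (n : ℕ) :
    serE q = polyE q n * PowerSeries.rescale (q ^ n) (serE q) := by
  induction n with
  | zero => simp [polyE]
  | succ n ih =>
    have h1 : PowerSeries.rescale (q ^ n) (serE q) = (1 + PowerSeries.C (q ^ n) * PowerSeries.X)
        * PowerSeries.rescale (q ^ (n + 1)) (serE q) := by
      conv_lhs => rw [serE_eq_mul_rescale hq hq1]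
      rw [map_mul, map_add, map_one, PowerSeries.rescale_X, PowerSeries.rescale_rescale, pow_succ']
    conv_lhs => rw [ih, h1]
    rw [polyE, polyE, prod_range_succ, mul_assoc]

theorem sum_ser1_mul_serE {q : ℂ} (hq : q ≠ 0) (hq1 : ∀ k : ℤ, k ≠ 0 → q ^ k ≠ 1) (j : ℕ) :
    ∀ {c : ℂ}, (∀ i : ℕ, c * q ^ i ≠ 1) →
      ∑ i ∈ range (j + 1), (-1) ^ i / (poch q q i * poch c q i)
        * (q ^ tri ((j - i : ℕ) : ℤ) / poch q q (j - i))
      = (-1) ^ j * (q ^ tri j) ^ 2 * c ^ j / (poch q q j * poch c q j) := by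
  induction j with
  | zero => simp
  | succ j ih =>
    intro c hc
    have hcq : ∀ i : ℕ, c * q * q ^ i ≠ 1 := fun i => by
      have := hc (i + 1)
      rwa [pow_succ', ← mul_assoc] at this
    have hj : poch q q (j + 1) ≠ 0 := poch_self_ne_zero hq1 _
    have hj' : 1 - q * q ^ j ≠ 0 := by rw [poch_succ] at hj; exact right_ne_zero_of_mul hj
    have key : (1 - q * q ^ j) * ∑ i ∈ range (j + 1 + 1), (-1) ^ i / (poch q q i * poch c q i)
          * (q ^ tri ((j + 1 - i : ℕ) : ℤ) / poch q q (j + 1 - i))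
        = -(c * q ^ j) / (1 - c) * ∑ i ∈ range (j + 1), (-1) ^ i / (poch q q i * poch (c * q) q i)
          * (q ^ tri ((j - i : ℕ) : ℤ) / poch q q (j - i)) := by
      -- The splitting 1 - q^(j+1) = (1 - q^(j+1-i)) + q^(j+1-i)(1 - q^i): each part cancels a
      -- factor of one denominator, and after an index shift both combine into the sum for j and cq.
      have split : ∀ i ∈ range (j + 1 + 1), (1 - q * q ^ j) *
          ((-1) ^ i / (poch q q i * poch c q i)
            * (q ^ tri ((j + 1 - i : ℕ) : ℤ) / poch q q (j + 1 - i)))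
          = (-1) ^ i / (poch q q i * poch c q i)
            * (q ^ tri ((j + 1 - i : ℕ) : ℤ) / poch q q (j + 1 - i)) * (1 - q ^ (j + 1 - i))
          + (-1) ^ i / (poch q q i * poch c q i)
            * (q ^ tri ((j + 1 - i : ℕ) : ℤ) / poch q q (j + 1 - i)) * q ^ (j + 1 - i)
            * (1 - q ^ i) := fun i hi => by
        have hi : i ≤ j + 1 := by simpa [Nat.lt_succ_iff] using hi
        have : q * q ^ j = q ^ (j + 1 - i) * q ^ i := by
          rw [← pow_add, Nat.sub_add_cancel hi, pow_succ']
        rw [this]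
        ring
      rw [mul_sum, sum_congr rfl split, sum_add_distrib, sum_range_succ, sum_range_succ' (n := j + 1)]
      simp only [Nat.sub_self, pow_zero, sub_self, mul_zero, add_zero]
      rw [← sum_add_distrib, mul_sum]
      refine sum_congr rfl fun i hi => ?_
      have hi : i ≤ j := by simpa [Nat.lt_succ_iff] using hi
      have h2 := poch_self_ne_zero hq1 (i + 1)
      have h4 := poch_self_ne_zero hq1 (j - i + 1)
      have h7 : 1 - c * q ^ i ≠ 0 := sub_ne_zero.2 (hc i).symm
      have h8 : poch c q i * (1 - c * q ^ i) = (1 - c) * poch (c * q) q i := by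
        rw [← poch_succ, poch_succ']
      have h9 : q ^ j = q ^ (j - i) * q ^ i := by rw [← pow_add, Nat.sub_add_cancel hi]
      rw [show j + 1 - i = j - i + 1 by omega, show j + 1 - (i + 1) = j - i by omega,
        Nat.cast_succ (j - i), tri_add, tri_one, add_zero, mul_one, zpow_add₀ hq, zpow_natCast, h9,
        poch_succ c, h8]
      rw [poch_succ] at h2 h4 ⊢
      rw [poch_succ q q i]
      have h10 := right_ne_zero_of_mul h2
      have h11 := right_ne_zero_of_mul h4
      have h12 : poch c q i = (1 - c) * poch (c * q) q i / (1 - c * q ^ i) := by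
        rw [eq_div_iff h7, h8]
      rw [h12, pow_succ' q (j - i), pow_succ' q i]
      field_simp
      ring
    rw [ih hcq] at key
    have e : (q ^ tri ((j + 1 : ℕ) : ℤ)) = q ^ tri j * q ^ j := by
      push_cast
      rw [tri_add, tri_one, add_zero, mul_one, zpow_add₀ hq, zpow_natCast]
    refine mul_left_cancel₀ hj' (key.trans ?_)
    rw [e, poch_succ q, poch_succ' c, mul_pow]
    generalize q ^ j = y at *
    rw [mul_comm q y] at *
    field_simp
    ring

/-- The classical relation between Jackson's first and second functions, through the factor
(-x²/4;q)_∞. -/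
theorem serE_mul_ser1 {q c : ℂ} (hq : q ≠ 0) (hq1 : ∀ k : ℤ, k ≠ 0 → q ^ k ≠ 1)
    (hc : ∀ i : ℕ, c * q ^ i ≠ 1) : serE q * ser1 q c = ser2 q c := by
  ext j
  rw [mul_comm, PowerSeries.coeff_mul, Nat.sum_antidiagonal_eq_sum_range_succ_mk]
  simpa [serE, ser1, ser2] using sum_ser1_mul_serE hq hq1 j hc

theorem Generic.natPow {q c : ℂ} (h : Generic q c) (i : ℕ) : c * q ^ i ≠ 1 := by
  simpa using h i

/-- The series of the `q`-Bessel function of fixed argument in the coefficients. -/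
noncomputable def serH (q : ℂ) (n : ℤ) (c : ℂ) : PowerSeries ℂ :=
  if 0 ≤ n then ser2 q c else ser1 q c

/-- The series of the `q`-Bessel function of shifted argument in the coefficients. -/
noncomputable def serG (q : ℂ) (n : ℤ) (c : ℂ) : PowerSeries ℂ :=
  PowerSeries.rescale (q ^ n) (if 0 ≤ n then ser1 q c else ser2 q c)

/-- The value of the coefficient `a_0`. -/
noncomputable def alpha (q u : ℂ) (M n : ℤ) : ℂ :=
  (-1) ^ M * u ^ (-n) * (qPoch u q M * qPoch u q (M - 1) / qPoch u q (-1))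
    * q ^ ((1 - M) * n + M - tri M)

/-- The polynomial `P^(2)_{M,n,ν}` in the variable `z = (x / 2) ^ 2`, with `u = q ^ ν`. -/
noncomputable def serP (q u : ℂ) (M n : ℤ) : PowerSeries ℂ :=
  PowerSeries.mk fun k => if (k : ℤ) ≤ g M n then
    (-u) ^ k * (cA q u M n (k + min M 0) - cB q u M n (k - max M 0)) else 0

/-- Passing between the kinds costs a factor independent of the parameter, so the product is
symmetric in c and d. This symmetry cancels the unwanted products in the three-term relation. -/
theorem serH_mul_ser2 {q c d : ℂ} (hq : q ≠ 0) (hq1 : ∀ k : ℤ, k ≠ 0 → q ^ k ≠ 1)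
    (hc : Generic q c) (hd : Generic q d) (n : ℤ) :
    serH q n c * ser2 q d = serH q n d * ser2 q c := by
  unfold serH
  split_ifs
  · ring
  · rw [← serE_mul_ser1 hq hq1 hd.natPow, ← serE_mul_ser1 hq hq1 hc.natPow]; ring

theorem qPoch_mul_self {q u : ℂ} (hq : q ≠ 0) (h : Generic q u) (k : ℤ) :
    qPoch (u * q) q k = qPoch u q (k + 1) / (1 - u) := by
  have h0 : 1 - u ≠ 0 := sub_ne_zero.2 (by simpa using (h 0).symm)
  have h1 : Generic q (u * q) := by simpa using h.mul_zpow hq 1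
  refine eq_of_int_recurrence (f := fun k => qPoch (u * q) q k)
    (g := fun k => qPoch u q (k + 1) / (1 - u)) (r := fun k => 1 - u * q * q ^ k)
    (fun k => sub_ne_zero.2 (h1 k).symm) ?_ (fun k => qPoch_add_one hq h1 k) (fun k => ?_) k
  · have h2 := qPoch_add_one hq h 0
    simp only [qPoch_zero, zpow_zero, mul_one, one_mul] at h2
    simp only [qPoch_zero]
    rw [h2, div_self h0]
  · rw [qPoch_add_one hq h (k + 1), zpow_add_one₀ hq]
    ring

section

variable {q u : ℂ} (hq : q ≠ 0) (hq1 : ∀ k : ℤ, k ≠ 0 → q ^ k ≠ 1) (hu : u ≠ 0) (h : Generic q u)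

include hq hq1 hu h

theorem neg_pow_mul_cA (M n : ℤ) (j : ℕ) :
    (-u) ^ j * cA q u M n j
      = alpha q u M n * PowerSeries.coeff j (serH q n u * serG q n (q ^ (2 - M) / u)) := by
  have h1 := h.qPoch_ne_zero hq (M - 1)
  have hs : ((-1 : ℂ) ^ j) * (-1) ^ (j - M) = (-1) ^ M := by
    rw [← zpow_natCast, ← zpow_add₀ (by norm_num), show (j : ℤ) + (j - M) = 2 * (j - M) + M by ring,
      zpow_add₀ (by norm_num), zpow_mul]
    simp
  unfold serH serG alpha
  split_ifs with hn
  · rw [cA_of_nonneg hq hq1 hu h hn, coeff_ser2_mul_ser1 hq hq1 hu h, neg_pow, ← hs]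
    have e : q ^ ((j - M + 1) * n - 2 * (j - M) - tri (j - M))
        = q ^ ((1 - M) * n + M - tri M) * q ^ ((n + M - 2) * j - tri j) := by
      rw [← zpow_add₀ hq, tri_sub]; congr 1; ring
    rw [e]
    field_simp
  · rw [cA_of_neg hq hq1 hu h hn, coeff_ser1_mul_ser2 hq hq1 hu h, neg_pow, ← hs]
    have e : q ^ ((j - M + 1) * (j + n) - 2 * (j - M) - tri (j - M))
        = q ^ ((1 - M) * n + M - tri M) * q ^ (tri j + n * j) := by
      rw [← zpow_add₀ hq, tri_sub]
      congr 1
      have := two_mul_tri j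
      linear_combination -this
    rw [e, show -(j : ℤ) - n = -n - j by ring, zpow_sub₀ hu, zpow_natCast u j]
    field_simp

theorem neg_pow_mul_cB (M n : ℤ) (b : ℕ) :
    (-u) ^ b * cB q u M n b
      = PowerSeries.coeff b (serH q n (q ^ (2 : ℤ) / u) * serG q n (u * q ^ M)) := by
  unfold serH serG
  split_ifs with hn
  · rw [cB_of_nonneg hq hq1 hu h hn, coeff_ser2_mul_ser1' hq hq1 hu h, neg_pow, zpow_neg,
      zpow_natCast]
    field_simp
  · rw [cB_of_neg hq hq1 hu h hn, coeff_ser1_mul_ser2' hq hq1 hu h, neg_pow]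
    have e : q ^ ((M + b + n - 1) * b) = q ^ (2 * tri b + (M + n) * b) := by
      congr 1
      have := two_mul_tri b
      linear_combination -this
    rw [e]
    ring

/-- The coefficients beyond `g M n` cancel, so the truncation in `serP` loses nothing. The powers of
X encode the index shifts by `min M 0` and `max M 0`. -/
theorem serP_eq (M n : ℤ) :
    serP q u M n
      = PowerSeries.C ((-u) ^ (-M).toNat * alpha q u M n)
          * (PowerSeries.X ^ (-M).toNat * (serH q n u * serG q n (q ^ (2 - M) / u)))
        - PowerSeries.C ((-u) ^ M.toNat)
          * (PowerSeries.X ^ M.toNat * (serH q n (q ^ (2 : ℤ) / u) * serG q n (u * q ^ M))) := by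
  ext k
  have h1 : PowerSeries.coeff k (serP q u M n)
      = (-u) ^ k * (cA q u M n (k + min M 0) - cB q u M n (k - max M 0)) := by
    rw [serP, PowerSeries.coeff_mk]
    split_ifs with hk
    · rfl
    · rw [cA_eq_cB_of_g_lt hq hq1 hu h (by omega), sub_self, mul_zero]
  rw [h1, map_sub, PowerSeries.coeff_C_mul, PowerSeries.coeff_C_mul, PowerSeries.coeff_X_pow_mul',
    PowerSeries.coeff_X_pow_mul', mul_sub]
  congr 1
  · split_ifs with hk
    · rw [mul_assoc, ← neg_pow_mul_cA hq hq1 hu h, ← mul_assoc, ← pow_add]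
      congr 2 <;> omega
    · rw [cA, if_neg (by omega), mul_zero, mul_zero]
  · split_ifs with hk
    · rw [← neg_pow_mul_cB hq hq1 hu h, ← mul_assoc, ← pow_add]
      congr 2 <;> omega
    · rw [cB, if_neg (by omega), mul_zero, mul_zero]

end

end

/-! ### The three-term relation for generic parameters -/

section

open Finset

section

variable {q u : ℂ} (hq : q ≠ 0) (hq1 : ∀ k : ℤ, k ≠ 0 → q ^ k ≠ 1) (hu : u ≠ 0) (h : Generic q u)

include hq h

theorem qPoch_neg_one_inv : (qPoch u q (-1))⁻¹ = 1 - u / q := by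
  have h1 := qPoch_add_one hq h (-1)
  simp only [Int.reduceNeg, neg_add_cancel, qPoch_zero, zpow_neg_one] at h1
  rw [inv_eq_of_mul_eq_one_right h1.symm]
  rfl

theorem alpha_one_zero : alpha q u 1 0 = -(q * (1 - u) * (1 - u / q)) := by
  have h2 := qPoch_neg_one_inv hq h
  have h3 := qPoch_add_one hq h 0
  simp only [qPoch_zero, zpow_zero, mul_one, one_mul, zero_add] at h3
  unfold alpha
  rw [div_eq_mul_inv, h2, h3]
  simp
  ring

include hu

/-- The first products in `serP q u (m + 1) n` and `serP q (u * q) m n` share the same shifted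
series; this compares their constants. -/
theorem alpha_mul_self (m n : ℤ) :
    alpha q (u * q) m n = -(q ^ (m - 1) / ((1 - u / q) * (1 - u))) * alpha q u (m + 1) n := by
  have h1 : 1 - u / q ≠ 0 := sub_ne_zero.2 (by simpa [div_eq_mul_inv] using (h (-1)).symm)
  have h2 := qPoch_neg_one_inv hq h
  unfold alpha
  rw [qPoch_mul_self hq h, qPoch_mul_self hq h, qPoch_mul_self hq h, mul_zpow,
    div_eq_mul_inv (qPoch u q (m + 1) * qPoch u q (m + 1 - 1)), h2, sub_add_cancel,
    add_sub_cancel_right, neg_add_cancel, qPoch_zero]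
  have e : q ^ (-n) * q ^ ((1 - m) * n + m - tri m)
      = q ^ (m - 1) * q ^ ((1 - (m + 1)) * n + (m + 1) - tri (m + 1)) := by
    rw [← zpow_add₀ hq, ← zpow_add₀ hq, tri_add, tri_one]; congr 1; ring
  have e2 : (-1 : ℂ) ^ (m + 1) = -(-1) ^ m := by rw [zpow_add_one₀ (by norm_num)]; ring
  rw [e2]
  have e3 : ∀ a b c d e f : ℂ, a * (b * c) * d * e = a * b * d * (c * e) := fun _ _ _ _ _ _ => by ring
  rw [e3 _ _ _ _ _ 0, e]
  generalize 1 - u / q = w at *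
  field_simp

include hq1

/-- Since `g 1 0 = 0`, the polynomial for M = 1, n = 0 is the constant a_0, and `serP_eq` divided by
it is the identity. -/
theorem casorati :
    ser2 q u * ser1 q (q / u) + PowerSeries.C (-(u / (q * (1 - u) * (1 - u / q)))) * PowerSeries.X
      * (ser2 q (q ^ (2 : ℤ) / u) * ser1 q (u * q)) = 1 := by
  have h0 : 1 - u ≠ 0 := sub_ne_zero.2 (by simpa using (h 0).symm)
  have h1 : 1 - u / q ≠ 0 := sub_ne_zero.2 (by simpa [div_eq_mul_inv] using (h (-1)).symm)
  have ha : alpha q u 1 0 ≠ 0 := by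
    rw [alpha_one_zero hq h]
    exact neg_ne_zero.2 (mul_ne_zero (mul_ne_zero hq h0) h1)
  have key := serP_eq hq hq1 hu h 1 0
  have hP : serP q u 1 0 = PowerSeries.C (alpha q u 1 0) := by
    ext k
    have hg : g 1 0 = 0 := by decide
    rw [serP, PowerSeries.coeff_mk, hg, PowerSeries.coeff_C]
    rcases k with _ | k
    · have := neg_pow_mul_cA hq hq1 hu h 1 0 0
      simp only [CharP.cast_eq_zero, pow_zero, one_mul, le_refl, if_true] at this ⊢
      rw [show (0 : ℤ) + min 1 0 = 0 by decide, show (0 : ℤ) - max 1 0 = -1 by decide, this, cB,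
        if_neg (by decide)]
      simp [serH, serG, ser1, ser2]
    · rw [if_neg (by push_cast; omega), if_neg (by omega)]
  rw [hP] at key
  simp only [serH, serG, le_refl, if_true, zpow_zero, PowerSeries.rescale_one, RingHom.id_apply,
    Int.reduceNeg, Int.reduceSub, zpow_one, Int.toNat_one, pow_one,
    show (-1 : ℤ).toNat = 0 from rfl, pow_zero, one_mul] at key
  have e : PowerSeries.C (-(u / (q * (1 - u) * (1 - u / q)))) * PowerSeries.C (alpha q u 1 0)
      = PowerSeries.C u := by
    rw [← map_mul, alpha_one_zero hq h]; congr 1; generalize 1 - u / q = w at *; field_simp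
  have e' : (PowerSeries.C (alpha q u 1 0) : PowerSeries ℂ) ≠ 0 := by
    simpa using ha
  refine mul_left_cancel₀ e' ?_
  rw [map_neg] at key
  linear_combination (-1 : PowerSeries ℂ) * key + PowerSeries.X * (ser2 q (q ^ (2 : ℤ) / u) * ser1 q (u * q)) * e

/-- For n ≥ 0 the factor (-z;q)_∞ is pulled out of the bracket; it splits as (-z;q)_n (-q^n z;q)_∞,
and the second part turns the shifted series into one of the second kind. For n < 0 the kinds
already match. -/
theorem casorati_mul_serG {c : ℂ} (hc : Generic q c) (n : ℤ) :
    serG q n c * (serH q n (q / u) * ser2 q u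
      + PowerSeries.C (-(u / (q * (1 - u) * (1 - u / q)))) * PowerSeries.X
        * (serH q n (q ^ (2 : ℤ) / u) * ser2 q (u * q)))
      = polyE q n.toNat * PowerSeries.rescale (q ^ n) (ser2 q c) := by
  have key := casorati hq hq1 hu h
  have h1 : Generic q (u * q) := by simpa using h.mul_zpow hq 1
  have h2 : Generic q (q / u) := by simpa using h.zpow_div hq hu 1
  have h3 := h.zpow_div hq hu 2
  unfold serG serH
  split_ifs with hn
  · lift n to ℕ using hn
    rw [Int.toNat_natCast, zpow_natCast, ← serE_mul_ser1 hq hq1 hc.natPow, map_mul, ← mul_assoc (polyE q n),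
      ← serE_eq_polyE_mul hq hq1, ← serE_mul_ser1 hq hq1 h2.natPow,
      ← serE_mul_ser1 hq hq1 h1.natPow]
    linear_combination serE q * PowerSeries.rescale (q ^ n) (ser1 q c) * key
  · rw [show n.toNat = 0 by omega, polyE, range_zero, prod_empty, one_mul]
    have e : ser1 q (q ^ (2 : ℤ) / u) * ser2 q (u * q) = ser2 q (q ^ (2 : ℤ) / u) * ser1 q (u * q) := by
      rw [← serE_mul_ser1 hq hq1 h1.natPow, ← serE_mul_ser1 hq hq1 h3.natPow]; ring
    rw [e]
    linear_combination PowerSeries.rescale (q ^ n) (ser2 q c) * key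

end

/-- The three-term relation as an identity of power series in `z = (x / 2) ^ 2`. -/
def SeriesRelation (q u : ℂ) (m n : ℤ) : Prop :=
  PowerSeries.C (u ^ m * q ^ tri m) * (PowerSeries.X ^ (m + 1).toNat
      * (polyE q n.toNat * PowerSeries.rescale (q ^ n) (ser2 q (u * q ^ (m + 1)))))
    = PowerSeries.C (q ^ (tri m - 1) * (-1) ^ max (m + 1) 0 * u ^ min (m + 1) 0
          / ((1 - u / q) * (1 - u)))
        * (PowerSeries.X * (serP q u (m + 1) n * ser2 q (u * q)))
      - PowerSeries.C (q ^ (tri (m - 1) - 1) * (-1) ^ max m 0 * (u * q) ^ min m 0)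
        * (PowerSeries.X ^ ((m + 1).toNat - m.toNat) * (serP q (u * q) m n * ser2 q u))

/-- Together with the next lemma: the sign and the power of u in the prefactor of R absorb the shift
factors of `serP_eq` uniformly in the sign of M. -/
theorem neg_pow_toNat_neg_mul {u : ℂ} (hu : u ≠ 0) (M : ℤ) :
    (-1) ^ max M 0 * u ^ min M 0 * (-u) ^ (-M).toNat = (-1 : ℂ) ^ M := by
  rcases le_total 0 M with hM | hM
  · simp [hM, Int.toNat_of_nonpos (neg_nonpos.2 hM)]
  · obtain ⟨N, rfl⟩ : ∃ N : ℕ, M = -N := ⟨(-M).toNat, by omega⟩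
    rw [max_eq_right hM, min_eq_left hM, neg_neg, Int.toNat_natCast, zpow_zero, one_mul, zpow_neg,
      zpow_neg, zpow_natCast, zpow_natCast, neg_pow u, ← inv_pow (-1 : ℂ)]
    have : u ^ N ≠ 0 := pow_ne_zero _ hu
    norm_num
    field_simp

theorem neg_pow_toNat_mul (u : ℂ) (M : ℤ) :
    (-1) ^ max M 0 * u ^ min M 0 * (-u) ^ M.toNat = u ^ M := by
  rcases le_total 0 M with hM | hM
  · lift M to ℕ using hM
    rw [max_eq_left (by omega), min_eq_right (by omega), Int.toNat_natCast, zpow_zero, mul_one,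
      zpow_natCast, zpow_natCast, ← mul_pow]
    simp
  · simp [hM, Int.toNat_of_nonpos hM]

theorem seriesRelation_of_generic {q u : ℂ} (hq : q ≠ 0) (hq1 : ∀ k : ℤ, k ≠ 0 → q ^ k ≠ 1)
    (hu : u ≠ 0) (h : Generic q u) (m n : ℤ) : SeriesRelation q u m n := by
  have huq : Generic q (u * q) := by simpa using h.mul_zpow hq 1
  have cas := casorati_mul_serG hq hq1 hu h (h.mul_zpow hq (m + 1)) n
  have hH := serH_mul_ser2 hq hq1 h huq n
  have a1 : q ^ (2 - m) / (u * q) = q ^ (2 - (m + 1)) / u := by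
    rw [show 2 - m = 2 - (m + 1) + 1 by ring, zpow_add_one₀ hq, mul_div_mul_right _ _ hq]
  have a2 : q ^ (2 : ℤ) / (u * q) = q / u := by
    rw [zpow_ofNat]; field_simp
  have a3 : u * q * q ^ m = u * q ^ (m + 1) := by rw [zpow_add_one₀ hq]; ring
  have P1 := serP_eq hq hq1 hu h (m + 1) n
  have P2 := serP_eq hq hq1 (mul_ne_zero hu hq) huq m n
  rw [a1, a2, a3, alpha_mul_self hq hu h] at P2
  have t : q ^ tri m = q ^ (tri (m - 1) - 1) * q ^ m := by
    rw [← zpow_add₀ hq, tri_sub, tri_one]; congr 1; ring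
  have t' : q ^ tri m = q ^ (tri m - 1) * q := by
    rw [← zpow_add_one₀ hq]; congr 1; ring
  have t'' : q ^ m = q ^ (m - 1) * q := by
    rw [← zpow_add_one₀ hq]; congr 1; ring
  have x1 : (PowerSeries.X : PowerSeries ℂ) * PowerSeries.X ^ (-(m + 1)).toNat
      = PowerSeries.X ^ ((m + 1).toNat - m.toNat) * PowerSeries.X ^ (-m).toNat := by
    rw [← pow_succ', ← pow_add]; congr 1; omega
  have x2 : (PowerSeries.X : PowerSeries ℂ) ^ (m + 1).toNat
      = PowerSeries.X ^ ((m + 1).toNat - m.toNat) * PowerSeries.X ^ m.toNat := by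
    rw [← pow_add]; congr 1; omega
  have n1 := neg_pow_toNat_neg_mul hu (m + 1)
  have n2 := neg_pow_toNat_mul u (m + 1)
  have n3 := neg_pow_toNat_neg_mul (mul_ne_zero hu hq) m
  have n4 := neg_pow_toNat_mul (u * q) m
  rw [zpow_add_one₀ (by norm_num)] at n1
  rw [zpow_add_one₀ hu] at n2
  rw [mul_zpow u q m] at n4
  unfold SeriesRelation
  rw [← cas, P1, P2]
  generalize alpha q u (m + 1) n = α
  generalize serG q n (q ^ (2 - (m + 1)) / u) = G₁
  generalize serG q n (u * q ^ (m + 1)) = G₂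
  set K₁ := q ^ (tri m - 1) * (-1) ^ max (m + 1) 0 * u ^ min (m + 1) 0
    / ((1 - u / q) * (1 - u)) with hK₁
  set K₂ := q ^ (tri (m - 1) - 1) * (-1) ^ max m 0 * (u * q) ^ min m 0 with hK₂
  set p₁ := (-u) ^ (-(m + 1)).toNat * α with hp₁
  set p₁' := (-(u * q)) ^ (-m).toNat * (-(q ^ (m - 1) / ((1 - u / q) * (1 - u))) * α) with hp₁'
  set κ := -(u / (q * (1 - u) * (1 - u / q))) with hκ
  -- The products with `G₁` enter with equal constants (`s1`) and cancel by `hH`. Those with `G₂`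
  -- have constants in the ratio of the Casoratian (`s2`, `s3`).
  have s1 : (PowerSeries.C K₁ * PowerSeries.C p₁ : PowerSeries ℂ)
      = PowerSeries.C K₂ * PowerSeries.C p₁' := by
    rw [← map_mul, ← map_mul]
    congr 1
    have e1 : K₁ * p₁ = q ^ (tri m - 1) / ((1 - u / q) * (1 - u)) * α * ((-1) ^ m * -1) := by
      rw [← n1, hK₁, hp₁]; ring
    have e2 : K₂ * p₁' = -(q ^ (tri (m - 1) - 1) * q ^ (m - 1) / ((1 - u / q) * (1 - u))) * α
        * (-1) ^ m := by
      rw [← n3, hK₂, hp₁']; ring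
    have e3 : q ^ (tri (m - 1) - 1) * q ^ (m - 1) = q ^ (tri m - 1) := by
      apply mul_right_cancel₀ hq
      rw [← t', t, t'']
      ring
    rw [e1, e2, e3]
    ring
  have s2 : (PowerSeries.C K₂ * PowerSeries.C ((-(u * q)) ^ m.toNat) : PowerSeries ℂ)
      = PowerSeries.C (u ^ m * q ^ tri m) := by
    rw [← map_mul]
    congr 1
    have e1 : K₂ * (-(u * q)) ^ m.toNat = q ^ (tri (m - 1) - 1) * (u ^ m * q ^ m) := by
      rw [← n4, hK₂]; ring
    rw [e1, t]
    ring
  have s3 : (PowerSeries.C K₁ * PowerSeries.C ((-u) ^ (m + 1).toNat) : PowerSeries ℂ)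
      = -(PowerSeries.C (u ^ m * q ^ tri m) * PowerSeries.C κ) := by
    rw [← map_mul, ← map_mul, ← map_neg]
    congr 1
    have e1 : K₁ * (-u) ^ (m + 1).toNat
        = q ^ (tri m - 1) / ((1 - u / q) * (1 - u)) * (u ^ m * u) := by
      rw [← n2, hK₁]; ring
    rw [e1, hκ, t']
    clear_value K₁ K₂
    generalize 1 - u / q = w at *
    field_simp
  generalize (PowerSeries.C (u ^ m * q ^ tri m) : PowerSeries ℂ) = c at *
  generalize (PowerSeries.C ((-(u * q)) ^ m.toNat) : PowerSeries ℂ) = d at *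
  generalize (PowerSeries.C ((-u) ^ (m + 1).toNat) : PowerSeries ℂ) = d' at *
  generalize (PowerSeries.X : PowerSeries ℂ) ^ (-(m + 1)).toNat = X₁ at *
  generalize (PowerSeries.X : PowerSeries ℂ) ^ (m + 1).toNat = X₂ at *
  generalize (PowerSeries.X : PowerSeries ℂ) ^ ((m + 1).toNat - m.toNat) = X₃ at *
  generalize (PowerSeries.X : PowerSeries ℂ) ^ (-m).toNat = X₄ at *
  generalize (PowerSeries.X : PowerSeries ℂ) ^ m.toNat = X₅ at *
  linear_combination (-PowerSeries.X * X₁ * G₁ * PowerSeries.C K₁ * PowerSeries.C p₁) * hH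
    - PowerSeries.X * X₁ * G₁ * serH q n (u * q) * ser2 q u * s1
    - PowerSeries.C K₂ * PowerSeries.C p₁' * G₁ * serH q n (u * q) * ser2 q u * x1
    - X₃ * X₅ * G₂ * serH q n (q / u) * ser2 q u * s2
    + c * G₂ * serH q n (q / u) * ser2 q u * x2
    + PowerSeries.X * X₂ * G₂ * serH q n (q ^ (2 : ℤ) / u) * ser2 q (u * q) * s3

end

/-! ### Extension to all admissible parameters -/

section

open Finset Filter Topology

/-- The coefficients of a family of power series depend continuously on the parameter. -/
def CoeffContinuousAt (F : ℂ → PowerSeries ℂ) (u₀ : ℂ) : Prop :=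
  ∀ k, ContinuousAt (fun u => PowerSeries.coeff k (F u)) u₀

namespace CoeffContinuousAt

variable {F G : ℂ → PowerSeries ℂ} {u₀ : ℂ}

theorem mul (hF : CoeffContinuousAt F u₀) (hG : CoeffContinuousAt G u₀) :
    CoeffContinuousAt (fun u => F u * G u) u₀ := fun k => by
  simp only [PowerSeries.coeff_mul]
  exact tendsto_finsetSum _ fun p _ => (hF p.1).mul (hG p.2)

theorem sub (hF : CoeffContinuousAt F u₀) (hG : CoeffContinuousAt G u₀) :
    CoeffContinuousAt (fun u => F u - G u) u₀ := fun k => by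
  simp only [map_sub]
  exact (hF k).sub (hG k)

theorem const (f : PowerSeries ℂ) : CoeffContinuousAt (fun _ => f) u₀ := fun _ => continuousAt_const

theorem C {f : ℂ → ℂ} (hf : ContinuousAt f u₀) :
    CoeffContinuousAt (fun u => PowerSeries.C (f u)) u₀ := fun k => by
  simp only [PowerSeries.coeff_C]
  split_ifs
  · exact hf
  · exact continuousAt_const

theorem rescale (hF : CoeffContinuousAt F u₀) (a : ℂ) :
    CoeffContinuousAt (fun u => PowerSeries.rescale a (F u)) u₀ := fun k => by
  simp only [PowerSeries.coeff_rescale]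
  exact continuousAt_const.mul (hF k)

end CoeffContinuousAt

section

variable {q u₀ : ℂ} {f : ℂ → ℂ}

theorem continuousAt_poch (hf : ContinuousAt f u₀) (k : ℕ) :
    ContinuousAt (fun u => poch (f u) q k) u₀ :=
  tendsto_finsetProd _ fun _ _ => continuousAt_const.sub (hf.mul continuousAt_const)

theorem coeffContinuousAt_ser2 (hq1 : ∀ k : ℕ, poch q q k ≠ 0) (hf : ContinuousAt f u₀)
    (h : ∀ k : ℕ, f u₀ * q ^ k ≠ 1) : CoeffContinuousAt (fun u => ser2 q (f u)) u₀ := fun k => by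
  simp only [ser2, PowerSeries.coeff_mk]
  exact (continuousAt_const.mul (hf.pow k)).div (continuousAt_const.mul (continuousAt_poch hf k))
    (mul_ne_zero (hq1 k) (poch_ne_zero fun i _ => h i))

theorem continuousAt_qPoch (hf : ContinuousAt f u₀) (M : ℤ)
    (h : ∀ k : ℕ, f u₀ * q ^ M * q ^ k ≠ 1) : ContinuousAt (fun u => qPoch (f u) q M) u₀ := by
  obtain ⟨N, rfl | rfl⟩ := M.eq_nat_or_neg
  · exact continuousAt_poch hf N
  · simp only [qPoch_neg_natCast]
    exact continuousAt_const.div (continuousAt_poch (hf.mul continuousAt_const) N)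
      (poch_ne_zero fun i _ => h i)

/-- For negative index the reciprocal is a finite product, so only nonnegative indices need a
nonvanishing condition. -/
theorem continuousAt_inv_qPoch (hf : ContinuousAt f u₀) (M : ℤ)
    (h : 0 ≤ M → qPoch (f u₀) q M ≠ 0) : ContinuousAt (fun u => (qPoch (f u) q M)⁻¹) u₀ := by
  obtain ⟨N, rfl | rfl⟩ := M.eq_nat_or_neg
  · exact (continuousAt_poch hf N).inv₀ (h (Int.natCast_nonneg N))
  · simp only [qPoch_neg_natCast, one_div, inv_inv]
    exact continuousAt_poch (hf.mul continuousAt_const) N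

section

variable (hq1 : ∀ k : ℕ, poch q q k ≠ 0) (hf : ContinuousAt f u₀) (h0 : f u₀ ≠ 0)

include hq1 hf h0

theorem continuousAt_termA {M : ℤ} (h : ∀ k : ℕ, f u₀ * q ^ k ≠ 1)
    (hM : ∀ k : ℕ, f u₀ * q ^ M * q ^ k ≠ 1) (x y t : ℤ) (j : ℕ)
    (hj : (0 : ℤ) ≤ j - M → qPoch (q ^ (2 : ℤ) / f u₀) q (j - M) ≠ 0) :
    ContinuousAt (fun u => termA q (f u) M x y t j) u₀ := by
  unfold termA
  simp only [div_eq_mul_inv (qPoch _ q M), mul_inv]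
  refine (((continuousAt_qPoch hf M hM).mul (continuousAt_const.mul (continuousAt_inv_qPoch
    (continuousAt_const.div hf h0) _ hj))).mul (continuousAt_const.mul (hf.zpow₀ y (Or.inl h0)))).mul
    (tendsto_finsetSum _ fun i _ => ?_)
  exact ((continuousAt_const.mul (continuousAt_poch (hf.mul continuousAt_const) i)).div
    (continuousAt_const.mul (continuousAt_poch hf i))
    (mul_ne_zero (hq1 i) (poch_ne_zero fun l _ => h l))).mul continuousAt_const

theorem continuousAt_termB {M : ℤ}
    (hM : ∀ k : ℕ, f u₀ * q ^ M * q ^ k ≠ 1) (x y t : ℤ) (j : ℕ)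
    (hj : qPoch (q ^ (2 : ℤ) / f u₀) q j ≠ 0) :
    ContinuousAt (fun u => termB q (f u) M x y t j) u₀ := by
  unfold termB
  simp only [one_div, mul_inv]
  refine ((continuousAt_const.mul (continuousAt_inv_qPoch
    (continuousAt_const.div hf h0) _ fun _ => hj)).mul
    (continuousAt_const.mul (hf.zpow₀ y (Or.inl h0)))).mul
    (tendsto_finsetSum _ fun i _ => ?_)
  exact ((continuousAt_const.mul (continuousAt_poch (hf.mul continuousAt_const) i)).div
    (continuousAt_const.mul (continuousAt_poch (hf.mul continuousAt_const) i))
    (mul_ne_zero (hq1 i) (poch_ne_zero fun l _ => hM l))).mul continuousAt_const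

theorem coeffContinuousAt_serP {M n : ℤ} (h : ∀ k : ℕ, f u₀ * q ^ k ≠ 1)
    (hM : ∀ k : ℕ, f u₀ * q ^ M * q ^ k ≠ 1)
    (hc : ∀ l : ℕ, (l : ℤ) ≤ g M n - max M 0 → poch (q ^ (2 : ℤ) / f u₀) q l ≠ 0) :
    CoeffContinuousAt (fun u => serP q (f u) M n) u₀ := fun k => by
  simp only [serP, PowerSeries.coeff_mk]
  split_ifs with hk
  · refine (hf.neg.pow k).mul (ContinuousAt.sub ?_ ?_)
    · unfold cA
      by_cases h1 : 0 ≤ (k : ℤ) + min M 0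
      · have h3 : ∀ h : (0 : ℤ) ≤ (((k : ℤ) + min M 0).toNat : ℤ) - M,
            qPoch (q ^ (2 : ℤ) / f u₀) q ((((k : ℤ) + min M 0).toNat : ℤ) - M) ≠ 0 := fun h3 => by
          obtain ⟨l, hl⟩ := Int.eq_ofNat_of_zero_le h3
          rw [hl, qPoch_natCast]
          exact hc l (by omega)
        simp only [if_pos h1]
        split_ifs
        · exact continuousAt_termA hq1 hf h0 h hM _ _ _ _ h3
        · exact continuousAt_termA hq1 hf h0 h hM _ _ _ _ h3
      · simp only [if_neg h1]
        exact continuousAt_const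
    · unfold cB
      by_cases h1 : 0 ≤ (k : ℤ) - max M 0
      · have h3 : qPoch (q ^ (2 : ℤ) / f u₀) q (((k : ℤ) - max M 0).toNat : ℤ) ≠ 0 := by
          rw [qPoch_natCast]
          exact hc _ (by omega)
        simp only [if_pos h1]
        split_ifs
        · exact continuousAt_termB hq1 hf h0 hM _ _ _ _ h3
        · exact continuousAt_termB hq1 hf h0 hM _ _ _ _ h3
      · simp only [if_neg h1]
        exact continuousAt_const
  · exact continuousAt_const

end

end

/-- The excluded set is countable, hence has dense complement in ℂ. -/
theorem frequently_generic (q u₀ : ℂ) : ∃ᶠ u in 𝓝 u₀, u ≠ 0 ∧ Generic q u := by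
  have hcount : ({0} ∪ Set.range fun k : ℤ => (q ^ k)⁻¹ : Set ℂ).Countable :=
    (Set.countable_singleton 0).union (Set.countable_range _)
  have hd := hcount.dense_compl ℂ
  refine (mem_closure_iff_frequently.1 (hd u₀)).mono fun u hu => ?_
  simp only [Set.mem_compl_iff, Set.mem_union, Set.mem_singleton_iff, Set.mem_range, not_or,
    not_exists] at hu
  exact ⟨hu.1, fun k hk => hu.2 k (inv_eq_of_mul_eq_one_left hk)⟩

theorem seriesRelation {q u : ℂ} (hq : q ≠ 0) (hq1 : ∀ k : ℤ, k ≠ 0 → q ^ k ≠ 1)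
    (hu : u ≠ 0) {m n : ℤ} (h : ∀ k : ℕ, u / q * q ^ k ≠ 1)
    (hm : ∀ k : ℕ, u * q ^ (m + 1) * q ^ k ≠ 1)
    (hc : qPoch (q ^ (2 : ℤ) / u) q (max (g (m + 1) n - max (m + 1) 0) 0) ≠ 0) :
    SeriesRelation q u m n := by
  have hp := poch_self_ne_zero hq1
  have h1 : ∀ k : ℕ, u * q ^ k ≠ 1 := fun k hk => h (k + 1) (by rw [pow_succ, ← hk]; field_simp)
  have h2 : ∀ k : ℕ, u * q * q ^ k ≠ 1 := fun k => by
    rw [mul_assoc, ← pow_succ']; exact h1 _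
  have hm' : ∀ k : ℕ, u * q * q ^ m * q ^ k ≠ 1 := fun k => by
    rw [mul_assoc u, ← zpow_one_add₀ hq, add_comm 1 m]; exact hm k
  have hu1 : 1 - u ≠ 0 := sub_ne_zero.2 (by simpa using (h1 0).symm)
  have hu2 : 1 - u / q ≠ 0 := sub_ne_zero.2 (by simpa using (h 0).symm)
  obtain ⟨N, hN⟩ := Int.eq_ofNat_of_zero_le (le_max_right (g (m + 1) n - max (m + 1) 0) 0)
  rw [hN] at hc
  have hc1 : ∀ l : ℕ, l ≤ N → poch (q ^ (2 : ℤ) / u) q l ≠ 0 := fun l hl h0 => by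
    refine hc ?_
    change poch _ q N = 0
    rw [← Nat.add_sub_cancel' hl, poch_add, h0, zero_mul]
  -- (q/u;q)_l is (1 - q/u)(q²/u;q)_(l-1), and the extra factor is nonzero because u/q ≠ 1.
  have hc2 : ∀ l : ℕ, l ≤ N + 1 → poch (q ^ (2 : ℤ) / (u * q)) q l ≠ 0 := fun l hl => by
    rcases l with _ | l
    · simp
    · have e : q ^ (2 : ℤ) / (u * q) * q = q ^ (2 : ℤ) / u := by field_simp
      rw [poch_succ', e]
      refine mul_ne_zero (sub_ne_zero.2 fun h3 => h 0 ?_) (hc1 l (by omega))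
      rw [eq_div_iff (mul_ne_zero hu hq), zpow_ofNat, one_mul, sq] at h3
      rw [mul_right_cancel₀ hq h3, pow_zero, mul_one, div_self hq]
  have hN1 : g m n - max m 0 ≤ N + 1 := by unfold g at *; omega
  have hcont : ∀ k : ℤ, ContinuousAt (fun u : ℂ => u ^ k) u := fun k =>
    continuousAt_id.zpow₀ k (Or.inl hu)
  have huq : ContinuousAt (fun u : ℂ => u * q) u := continuousAt_id.mul continuousAt_const
  have hL : CoeffContinuousAt (fun u => PowerSeries.C (u ^ m * q ^ tri m)
      * (PowerSeries.X ^ (m + 1).toNat * (polyE q n.toNat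
        * PowerSeries.rescale (q ^ n) (ser2 q (u * q ^ (m + 1)))))) u :=
    (CoeffContinuousAt.C ((hcont m).mul continuousAt_const)).mul ((CoeffContinuousAt.const _).mul
      ((CoeffContinuousAt.const _).mul ((coeffContinuousAt_ser2 hp
        (continuousAt_id.mul continuousAt_const) hm).rescale _)))
  have hR₁ : CoeffContinuousAt (fun u => PowerSeries.C (q ^ (tri m - 1) * (-1) ^ max (m + 1) 0
      * u ^ min (m + 1) 0 / ((1 - u / q) * (1 - u)))
        * (PowerSeries.X * (serP q u (m + 1) n * ser2 q (u * q)))) u :=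
    (CoeffContinuousAt.C ((continuousAt_const.mul (hcont _)).div
      ((continuousAt_const.sub (continuousAt_id.div_const q)).mul
        (continuousAt_const.sub continuousAt_id)) (mul_ne_zero hu2 hu1))).mul
      ((CoeffContinuousAt.const _).mul ((coeffContinuousAt_serP hp continuousAt_id hu h1 hm
        fun l hl => hc1 l (by omega)).mul (coeffContinuousAt_ser2 hp huq h2)))
  have hR₂ : CoeffContinuousAt (fun u => PowerSeries.C (q ^ (tri (m - 1) - 1) * (-1) ^ max m 0
      * (u * q) ^ min m 0) * (PowerSeries.X ^ ((m + 1).toNat - m.toNat)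
        * (serP q (u * q) m n * ser2 q u))) u :=
    (CoeffContinuousAt.C (continuousAt_const.mul
      (huq.zpow₀ _ (Or.inl (mul_ne_zero hu hq))))).mul
      ((CoeffContinuousAt.const _).mul ((coeffContinuousAt_serP hp huq (mul_ne_zero hu hq) h2 hm'
        fun l hl => hc2 l (by omega)).mul (coeffContinuousAt_ser2 hp continuousAt_id h1)))
  ext k
  exact tendsto_nhds_unique_of_frequently_eq (hL k) ((hR₁.sub hR₂) k)
    ((frequently_generic q u).mono fun v hv =>
      congrArg (PowerSeries.coeff k) (seriesRelation_of_generic hq hq1 hv.1 hv.2 m n))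

end

/-! ### Evaluation of power series -/

section

open Finset Filter Topology

/-- The power series `f` converges absolutely at `z`. -/
def EvSummable (z : ℂ) (f : PowerSeries ℂ) : Prop :=
  Summable fun k => ‖PowerSeries.coeff k f * z ^ k‖

/-- The value at `z` of the power series `f`. -/
noncomputable def ev (z : ℂ) (f : PowerSeries ℂ) : ℂ := ∑' k, PowerSeries.coeff k f * z ^ k

theorem coeff_mul_mul_pow (z : ℂ) (f g : PowerSeries ℂ) (k : ℕ) :
    PowerSeries.coeff k (f * g) * z ^ k = ∑ p ∈ antidiagonal k,
      (PowerSeries.coeff p.1 f * z ^ p.1) * (PowerSeries.coeff p.2 g * z ^ p.2) := by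
  rw [PowerSeries.coeff_mul, sum_mul]
  refine sum_congr rfl fun p hp => ?_
  rw [← mem_antidiagonal.1 hp, pow_add]
  ring

theorem EvSummable.mul {z : ℂ} {f g : PowerSeries ℂ} (hf : EvSummable z f) (hg : EvSummable z g) :
    EvSummable z (f * g) := by
  unfold EvSummable
  simp only [coeff_mul_mul_pow]
  exact summable_norm_sum_mul_antidiagonal_of_summable_norm
    (f := fun k => PowerSeries.coeff k f * z ^ k) (g := fun k => PowerSeries.coeff k g * z ^ k) hf hg

theorem ev_mul {z : ℂ} {f g : PowerSeries ℂ} (hf : EvSummable z f) (hg : EvSummable z g) :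
    ev z (f * g) = ev z f * ev z g := by
  unfold ev
  rw [tsum_mul_tsum_eq_tsum_sum_antidiagonal_of_summable_norm hf hg]
  simp only [coeff_mul_mul_pow]

theorem ev_sub {z : ℂ} {f g : PowerSeries ℂ} (hf : EvSummable z f) (hg : EvSummable z g) :
    ev z (f - g) = ev z f - ev z g := by
  unfold ev
  rw [← (Summable.of_norm hf).tsum_sub (Summable.of_norm hg)]
  simp [sub_mul]

theorem evSummable_of_finite {z : ℂ} {f : PowerSeries ℂ} {N : ℕ}
    (h : ∀ k, N ≤ k → PowerSeries.coeff k f = 0) : EvSummable z f :=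
  summable_of_ne_finset_zero (s := range N) fun k hk => by
    rw [h k (by simpa using hk), zero_mul, norm_zero]

theorem ev_of_finite {z : ℂ} {f : PowerSeries ℂ} {N : ℕ}
    (h : ∀ k, N ≤ k → PowerSeries.coeff k f = 0) :
    ev z f = ∑ k ∈ range N, PowerSeries.coeff k f * z ^ k :=
  tsum_eq_sum fun k hk => by rw [h k (by simpa using hk), zero_mul]

theorem evSummable_coe (z : ℂ) (p : Polynomial ℂ) : EvSummable z (p : PowerSeries ℂ) :=
  evSummable_of_finite (N := p.natDegree + 1) fun k hk => by
    rw [Polynomial.coeff_coe, Polynomial.coeff_eq_zero_of_natDegree_lt hk]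

theorem ev_coe (z : ℂ) (p : Polynomial ℂ) : ev z (p : PowerSeries ℂ) = p.eval z := by
  rw [ev_of_finite (N := p.natDegree + 1) fun k hk => by
    rw [Polynomial.coeff_coe, Polynomial.coeff_eq_zero_of_natDegree_lt hk],
    Polynomial.eval_eq_sum_range]
  simp

theorem evSummable_C (z a : ℂ) : EvSummable z (PowerSeries.C a) := by
  simpa using evSummable_coe z (Polynomial.C a)

theorem ev_C (z a : ℂ) : ev z (PowerSeries.C a) = a := by
  simpa using ev_coe z (Polynomial.C a)

theorem evSummable_X_pow (z : ℂ) (n : ℕ) : EvSummable z (PowerSeries.X ^ n) := by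
  simpa using evSummable_coe z (Polynomial.X ^ n)

theorem ev_X_pow (z : ℂ) (n : ℕ) : ev z (PowerSeries.X ^ n) = z ^ n := by
  simpa using ev_coe z (Polynomial.X ^ n)

theorem polyE_eq_coe (q : ℂ) (n : ℕ) : polyE q n
    = ((∏ i ∈ range n, (1 + Polynomial.C (q ^ i) * Polynomial.X) : Polynomial ℂ) : PowerSeries ℂ) := by
  induction n with
  | zero => simp [polyE]
  | succ n ih =>
    rw [polyE, prod_range_succ, prod_range_succ, Polynomial.coe_mul, ← ih, ← polyE]
    simp

theorem evSummable_polyE (q z : ℂ) (n : ℕ) : EvSummable z (polyE q n) := by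
  rw [polyE_eq_coe]
  exact evSummable_coe z _

theorem ev_polyE (q z : ℂ) (n : ℕ) : ev z (polyE q n) = poch (-z) q n := by
  rw [polyE_eq_coe, ev_coe, Polynomial.eval_prod]
  refine prod_congr rfl fun i _ => ?_
  simp
  ring

theorem coeff_rescale_mul_pow (a z : ℂ) (f : PowerSeries ℂ) (k : ℕ) :
    PowerSeries.coeff k (PowerSeries.rescale a f) * z ^ k
      = PowerSeries.coeff k f * (a * z) ^ k := by
  rw [PowerSeries.coeff_rescale, mul_pow]
  ring

theorem EvSummable.rescale {a z : ℂ} {f : PowerSeries ℂ} (hf : EvSummable (a * z) f) :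
    EvSummable z (PowerSeries.rescale a f) := by
  unfold EvSummable at *
  simpa only [coeff_rescale_mul_pow] using hf

theorem ev_rescale (a z : ℂ) (f : PowerSeries ℂ) :
    ev z (PowerSeries.rescale a f) = ev (a * z) f := by
  simp only [ev, coeff_rescale_mul_pow]

/-- Ratio test: consecutive terms have a quotient of order q^(2k), so the series converges for every
z. -/
theorem evSummable_ser2 {q c z : ℂ} (hq : q ≠ 0) (hq1 : ‖q‖ < 1) (hc : c ≠ 0)
    (hcq : ∀ k : ℕ, c * q ^ k ≠ 1) (hz : z ≠ 0) : EvSummable z (ser2 q c) := by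
  have hqk : ∀ k : ℕ, q * q ^ k ≠ 1 := fun k h => by
    have h1 : ‖q * q ^ k‖ < 1 := by
      rw [← pow_succ', norm_pow]
      exact pow_lt_one₀ (norm_nonneg q) hq1 (by omega)
    rw [h, norm_one] at h1
    exact lt_irrefl _ h1
  have hne : ∀ k, PowerSeries.coeff k (ser2 q c) * z ^ k ≠ 0 := fun k => by
    rw [ser2, PowerSeries.coeff_mk]
    refine mul_ne_zero (div_ne_zero (mul_ne_zero (mul_ne_zero (pow_ne_zero _ (by norm_num))
      (pow_ne_zero _ (zpow_ne_zero _ hq))) (pow_ne_zero _ hc)) (mul_ne_zero ?_ ?_))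
      (pow_ne_zero _ hz)
    · exact poch_ne_zero fun i _ => hqk i
    · exact poch_ne_zero fun i _ => hcq i
  refine Summable.norm (summable_of_ratio_test_tendsto_lt_one zero_lt_one
    (Eventually.of_forall hne) ?_)
  have hratio : ∀ k, ‖PowerSeries.coeff (k + 1) (ser2 q c) * z ^ (k + 1)‖
      / ‖PowerSeries.coeff k (ser2 q c) * z ^ k‖
      = ‖-(q ^ k) ^ 2 * (c * z) / ((1 - q * q ^ k) * (1 - c * q ^ k))‖ := fun k => by
    rw [← norm_div]
    congr 1
    rw [div_eq_iff (hne k)]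
    simp only [ser2, PowerSeries.coeff_mk]
    push_cast
    rw [poch_succ, poch_succ, tri_add, tri_one, add_zero, mul_one, zpow_add₀ hq, zpow_natCast]
    have h1 : poch q q k ≠ 0 := poch_ne_zero fun i _ => hqk i
    have h2 : poch c q k ≠ 0 := poch_ne_zero fun i _ => hcq i
    have h3 := sub_ne_zero.2 (hqk k).symm
    have h4 := sub_ne_zero.2 (hcq k).symm
    rw [div_mul_eq_mul_div, div_mul_eq_mul_div, div_mul_eq_mul_div, ← mul_div_assoc, div_div,
      div_eq_div_iff (mul_ne_zero (mul_ne_zero h1 h3) (mul_ne_zero h2 h4))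
      (mul_ne_zero (mul_ne_zero h1 h2) (mul_ne_zero h3 h4))]
    ring
  simp only [hratio]
  have hp : Tendsto (fun k => q ^ k) atTop (𝓝 0) := tendsto_pow_atTop_nhds_zero_of_norm_lt_one hq1
  have ht : Tendsto (fun k => -(q ^ k) ^ 2 * (c * z) / ((1 - q * q ^ k) * (1 - c * q ^ k))) atTop
      (𝓝 (-0 ^ 2 * (c * z) / ((1 - q * 0) * (1 - c * 0)))) :=
    ((hp.pow 2).neg.mul tendsto_const_nhds).div ((tendsto_const_nhds.sub (tendsto_const_nhds.mul hp)).mul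
      (tendsto_const_nhds.sub (tendsto_const_nhds.mul hp))) (by simp)
  simpa using ht.norm

theorem summable_norm_mul_pow {q : ℂ} (hq1 : ‖q‖ < 1) (a : ℂ) :
    Summable fun k : ℕ => ‖-(a * q ^ k)‖ := by
  simp only [norm_neg, norm_mul, norm_pow]
  exact (summable_geometric_of_lt_one (norm_nonneg q) hq1).mul_left _

theorem multipliable_one_sub_mul_pow {q : ℂ} (hq1 : ‖q‖ < 1) (a : ℂ) :
    Multipliable fun k : ℕ => 1 - a * q ^ k := by
  simpa only [← sub_eq_add_neg] using
    multipliable_one_add_of_summable (summable_norm_mul_pow hq1 a)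

theorem qPochInf_eq_mul {q : ℂ} (hq1 : ‖q‖ < 1) (a : ℂ) :
    qPochInf a q = (1 - a) * qPochInf (a * q) q := by
  have h : ∀ k : ℕ, 1 - a * q ^ (k + 1) = 1 - a * q * q ^ k := fun k => by ring
  unfold qPochInf
  rw [tprod_eq_zero_mul']
  · simp only [h, pow_zero, mul_one]
  · simp only [h]
    exact multipliable_one_sub_mul_pow hq1 _

theorem qPochInf_eq_poch_mul {q : ℂ} (hq1 : ‖q‖ < 1) (a : ℂ) (k : ℕ) :
    qPochInf a q = poch a q k * qPochInf (a * q ^ k) q := by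
  induction k with
  | zero => simp
  | succ k ih => rw [ih, qPochInf_eq_mul hq1 (a * q ^ k), poch_succ, pow_succ]; ring_nf

theorem qPochInf_ne_zero {q a : ℂ} (hq1 : ‖q‖ < 1) (h : ∀ k : ℕ, a * q ^ k ≠ 1) :
    qPochInf a q ≠ 0 := by
  have := tprod_one_add_ne_zero_of_summable (f := fun k : ℕ => -(a * q ^ k))
    (fun k => by rw [← sub_eq_add_neg]; exact sub_ne_zero.2 (h k).symm)
    (summable_norm_mul_pow hq1 a)
  simp only [← sub_eq_add_neg] at this
  exact this

end

/-! ### The `q`-Bessel functions and `q`-Lommel polynomials as values of series -/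

section

open Finset

theorem basicHyp_two_one {q : ℂ} (hq : q ≠ 0) (j : ℕ) (b c t : ℂ) :
    basicHyp [q ^ (-(j : ℤ)), b] [c] q t
      = ∑ i ∈ range (j + 1), poch (q ^ (-(j : ℤ))) q i * poch b q i / (poch q q i * poch c q i)
        * t ^ i := by
  have h : ∀ i ∉ range (j + 1), poch (q ^ (-(j : ℤ))) q i = 0 := fun i hi => by
    refine prod_eq_zero (i := j) (by simp at *; omega) ?_
    rw [← zpow_natCast, ← zpow_add₀ hq]
    simp
  rw [basicHyp, tsum_eq_sum (s := range (j + 1))]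
  · simp [qPoch_natCast]
  · intro i hi
    simp only [List.map_cons, List.map_nil, List.prod_cons, qPoch_natCast, h i hi, zero_mul,
      zero_div]

theorem coeff_serP_eq_zero (q u : ℂ) (m n : ℤ) (k : ℕ) (hk : (g m n + 1).toNat ≤ k) :
    PowerSeries.coeff k (serP q u m n) = 0 := by
  rw [serP, PowerSeries.coeff_mk, if_neg (by omega)]

theorem J2_eq_ev (q : ℝ) (ν x : ℂ) :
    J2 q ν x = qPochInf ((q : ℂ) ^ (ν + 1)) q / qPochInf q q * (x / 2) ^ ν
      * ev ((x / 2) ^ 2) (ser2 q ((q : ℂ) ^ (ν + 1))) := by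
  rw [J2, basicHyp, ev]
  congr 2
  funext k
  rw [ser2, PowerSeries.coeff_mk]
  simp only [List.map_nil, List.prod_nil, List.map_cons, List.prod_cons, mul_one, List.length_nil,
    List.length_cons, qPoch_natCast, tri_natCast, zpow_natCast]
  -- For ₀φ₁ the exponent 1 + s - r is 2, so the inner sign disappears and the remaining (-1)^k
  -- comes from the argument.
  rw [show (1 + ((0 + 1 : ℕ) : ℤ) - ((0 : ℕ) : ℤ) : ℤ) = ((2 : ℕ) : ℤ) from rfl, zpow_natCast,
    show -(x ^ 2 * (q : ℂ) ^ (ν + 1)) / 4 = -1 * (q : ℂ) ^ (ν + 1) * (x / 2) ^ 2 by ring,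
    mul_pow _ ((x / 2) ^ 2), mul_pow (-1 : ℂ), mul_pow ((-1 : ℂ) ^ k)]
  have : ((-1 : ℂ) ^ k) ^ 2 = 1 := by rw [← pow_mul, mul_comm, pow_mul]; simp
  rw [this]
  ring

section

variable {q : ℝ} (hq0 : 0 < q)

include hq0

theorem cpow_add_intCast (ν : ℂ) (k : ℤ) : (q : ℂ) ^ (ν + k) = (q : ℂ) ^ ν * (q : ℂ) ^ k := by
  rw [Complex.cpow_add _ _ (by exact_mod_cast hq0.ne'), Complex.cpow_intCast]

theorem cpow_int_sub_int_mul (ν : ℂ) (k l : ℤ) :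
    (q : ℂ) ^ ((k : ℂ) - (l : ℂ) * ν) = (q : ℂ) ^ k * ((q : ℂ) ^ ν) ^ (-l) := by
  rw [Complex.cpow_sub _ _ (by exact_mod_cast hq0.ne'), Complex.cpow_intCast, Complex.cpow_int_mul,
    zpow_neg, div_eq_mul_inv]

theorem cpow_two_sub (ν : ℂ) : (q : ℂ) ^ (2 - ν) = (q : ℂ) ^ (2 : ℤ) / (q : ℂ) ^ ν := by
  rw [Complex.cpow_sub _ _ (by exact_mod_cast hq0.ne'), ← Complex.cpow_intCast]
  norm_num

theorem coeff_eq_cA (m n : ℤ) (ν : ℂ) (j : ℤ) :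
    (if 0 ≤ n then coeffA q m n ν j else coeffA' q m n ν j) = cA q ((q : ℂ) ^ ν) m n j := by
  have hq : (q : ℂ) ≠ 0 := by exact_mod_cast hq0.ne'
  unfold cA
  split_ifs with hn hj hj
  · lift j to ℕ using hj
    rw [coeffA, termA, basicHyp_two_one hq, cpow_int_sub_int_mul hq0, cpow_two_sub hq0,
      Int.toNat_natCast, qPoch_natCast, show ν + m - (j : ℤ) - 1 = ν + ((m - j - 1 : ℤ) : ℂ) by
        push_cast; ring, cpow_add_intCast hq0]
  · rw [coeffA, qPoch_self_neg hq (by omega)]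
    simp
  · lift j to ℕ using hj
    rw [coeffA', termA, basicHyp_two_one hq, cpow_int_sub_int_mul hq0, cpow_two_sub hq0,
      Int.toNat_natCast, qPoch_natCast, show ν + m - (j : ℤ) - 1 = ν + ((m - j - 1 : ℤ) : ℂ) by
        push_cast; ring, cpow_add_intCast hq0]
  · rw [coeffA', qPoch_self_neg hq (by omega)]
    simp

theorem coeff_eq_cB (m n : ℤ) (ν : ℂ) (j : ℤ) :
    (if 0 ≤ n then coeffB q m n ν j else coeffB' q m n ν j) = cB q ((q : ℂ) ^ ν) m n j := by
  have hq : (q : ℂ) ≠ 0 := by exact_mod_cast hq0.ne'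
  unfold cB
  split_ifs with hn hj hj
  · lift j to ℕ using hj
    rw [coeffB, termB, basicHyp_two_one hq, cpow_int_sub_int_mul hq0, cpow_two_sub hq0,
      Int.toNat_natCast, qPoch_natCast, show ν - (j : ℤ) - 1 = ν + ((-j - 1 : ℤ) : ℂ) by
        push_cast; ring, cpow_add_intCast hq0, cpow_add_intCast hq0]
  · rw [coeffB, qPoch_self_neg hq (by omega)]
    simp
  · lift j to ℕ using hj
    rw [coeffB', termB, basicHyp_two_one hq, show -(((j : ℤ) : ℂ) * ν) = ((0 : ℤ) : ℂ) - ((j : ℤ) : ℂ) * ν by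
        simp, cpow_int_sub_int_mul hq0, cpow_two_sub hq0,
      Int.toNat_natCast, qPoch_natCast, show ν - (j : ℤ) - 1 = ν + ((-j - 1 : ℤ) : ℂ) by
        push_cast; ring, cpow_add_intCast hq0, cpow_add_intCast hq0]
  · rw [coeffB', qPoch_self_neg hq (by omega)]
    simp

theorem P2_eq_ev (m n : ℤ) (ν x : ℂ) :
    P2 q m n ν x = ev ((x / 2) ^ 2) (serP q ((q : ℂ) ^ ν) m n) := by
  rw [ev_of_finite (coeff_serP_eq_zero _ _ m n), P2]
  refine sum_congr rfl fun k hk => ?_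
  have hk : (k : ℤ) ≤ g m n := by simp at hk; omega
  rw [serP, PowerSeries.coeff_mk, if_pos hk, ← coeff_eq_cA hq0, ← coeff_eq_cB hq0,
    Complex.cpow_nat_mul, pow_mul, neg_pow]
  split_ifs <;> ring

end

theorem exists_polynomial_P2 (q : ℝ) (m n : ℤ) (ν : ℂ) : ∃ p : Polynomial ℂ,
    (∀ k : ℕ, g m n < (k : ℤ) → p.coeff k = 0) ∧ ∀ x : ℂ, P2 q m n ν x = p.eval (x ^ 2) := by
  refine ⟨∑ j ∈ range (g m n + 1).toNat, Polynomial.monomial j ((1 / 4) ^ j * (-1) ^ j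
    * (q : ℂ) ^ ((j : ℂ) * ν) *
      (if 0 ≤ n then coeffA q m n ν (j + min m 0) - coeffB q m n ν (j - max m 0)
        else coeffA' q m n ν (j + min m 0) - coeffB' q m n ν (j - max m 0))), fun k hk => ?_,
    fun x => ?_⟩
  · rw [Polynomial.finsetSum_coeff]
    refine sum_eq_zero fun j hj => Polynomial.coeff_monomial_of_ne _ ?_
    simp at hj
    omega
  · rw [P2, Polynomial.eval_finsetSum]
    refine sum_congr rfl fun j _ => ?_
    rw [Polynomial.eval_monomial, pow_mul, show (x / 2) ^ 2 = 1 / 4 * x ^ 2 by ring, mul_pow]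
    ring

end

/-! ### The three-term relation for functions -/

section

open Finset

theorem cast_tri (m : ℤ) : ((tri m : ℤ) : ℂ) = (m : ℂ) * ((m : ℂ) - 1) / 2 := by
  have h : (((2 * tri m : ℤ)) : ℂ) = ((m * (m - 1) : ℤ) : ℂ) := congrArg _ (two_mul_tri m)
  push_cast at h
  linear_combination h / 2

/-- Pure algebra on opaque quantities. `h` is the evaluated series relation, `Z` the power of z by
which it was multiplied, `E` the value of (-z;q)_n, and `y` is x/2. -/
theorem three_term_clear_denominators
    {pw pw' p Q Qq Q₀ Q₁ v w y F₁ F₂ F₃ A₁ A₂ a₁ a₂ b₁ b₂ c₁ c₂ d e y₁ y₂ E Z Z' : ℂ}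
    (hZ : Z ≠ 0) (hE : E ≠ 0) (hy : y ≠ 0) (hQ₀ : Q₀ ≠ 0) (hQ₁ : Q₁ ≠ 0)
    (h₁ : y₁ * Z = w * y ^ 2) (h₂ : y₂ * Z = w * Z' * y) (hp : pw * pw' = p)
    (h : p * (Z * (E * F₃)) = c₁ * a₁ * b₁ / (d * e) * (y ^ 2 * (A₁ * F₁))
      - c₂ * a₂ * b₂ * (Z' * (A₂ * F₂))) :
    pw * (Q / Qq * (v * w * pw') * F₃)
      = Q / (d * (e * Q₁) * E) * a₁ * (b₁ * c₁) * y₁ * A₁ * (Q₁ / Qq * v * F₁)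
        - Q / (Q₀ * E) * a₂ * (b₂ * c₂) * y₂ * A₂ * (Q₀ / Qq * (v / y) * F₂) := by
  have t₁ : Z * E * (Q / (d * (e * Q₁) * E) * a₁ * (b₁ * c₁) * y₁ * A₁ * (Q₁ / Qq * v * F₁))
      = Q / Qq * v * (c₁ * a₁ * b₁ / (d * e)) * A₁ * F₁ * (y₁ * Z) := by
    have k : E * (Q / (d * (e * Q₁) * E)) * Q₁ = Q / (d * e) := by
      rw [show d * (e * Q₁) * E = d * e * (Q₁ * E) by ring]
      generalize d * e = f
      field_simp
    rw [div_eq_mul_inv _ Qq, div_eq_mul_inv _ Qq, div_eq_mul_inv _ (d * e)]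
    rw [div_eq_mul_inv Q (d * e)] at k
    generalize Q / (d * (e * Q₁) * E) = r at *
    generalize (d * e)⁻¹ = s at *
    linear_combination (Z * a₁ * (b₁ * c₁) * y₁ * A₁ * (Qq⁻¹ * v * F₁)) * k
  have t₂ : Z * E * (Q / (Q₀ * E) * a₂ * (b₂ * c₂) * y₂ * A₂ * (Q₀ / Qq * (v / y) * F₂))
      = Q / Qq * v * (c₂ * a₂ * b₂) * A₂ * F₂ * (y₂ * Z) / y := by
    have k : E * (Q / (Q₀ * E)) * Q₀ = Q := by field_simp
    rw [div_eq_mul_inv _ Qq, div_eq_mul_inv _ Qq, div_eq_mul_inv _ y, div_eq_mul_inv _ y]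
    generalize Q / (Q₀ * E) = r at *
    linear_combination (Z * a₂ * (b₂ * c₂) * y₂ * A₂ * (Qq⁻¹ * (v * y⁻¹) * F₂)) * k
  have t₃ : Q / Qq * v * (c₂ * a₂ * b₂) * A₂ * F₂ * (w * Z' * y) / y
      = Q / Qq * v * (c₂ * a₂ * b₂) * A₂ * F₂ * (w * Z') := by
    rw [← mul_assoc, ← mul_assoc, mul_div_cancel_right₀ _ hy, ← mul_assoc]
  refine mul_left_cancel₀ (mul_ne_zero hZ hE) ?_
  rw [mul_sub, t₁, t₂, h₁, h₂, t₃]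
  linear_combination (Z * E * Q / Qq * v * w * F₃) * hp + (Q / Qq * v * w) * h

theorem mul_cpow_half_div_two_sq (q : ℝ) (x : ℂ) (n : ℤ) :
    (x * (q : ℂ) ^ ((n : ℂ) / 2) / 2) ^ 2 = (q : ℂ) ^ n * (x / 2) ^ 2 := by
  have : ((q : ℂ) ^ ((n : ℂ) / 2)) ^ 2 = (q : ℂ) ^ n := by
    rw [← Complex.cpow_nat_mul, ← Complex.cpow_intCast]
    congr 1
    push_cast
    ring
  rw [← this]
  ring

section

variable {q : ℝ} (hq0 : 0 < q)

include hq0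

/-- A positive real factor can be taken out of a principal power, since it does not change the
argument. -/
theorem mul_cpow_half_div_two {x : ℂ} (hx : x ≠ 0) (n : ℤ) (w : ℂ) :
    (x * (q : ℂ) ^ ((n : ℂ) / 2) / 2) ^ w = (x / 2) ^ w * (q : ℂ) ^ ((n : ℂ) / 2 * w) := by
  have hr : 0 < q ^ ((n : ℝ) / 2) := Real.rpow_pos_of_pos hq0 _
  have h2 : x / 2 ≠ 0 := div_ne_zero hx two_ne_zero
  have e : x * (q : ℂ) ^ ((n : ℂ) / 2) / 2 = ((q ^ ((n : ℝ) / 2) : ℝ) : ℂ) * (x / 2) := by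
    rw [Complex.ofReal_cpow hq0.le]
    push_cast
    ring
  rw [e, Complex.cpow_def_of_ne_zero (mul_ne_zero (by exact_mod_cast hr.ne') h2),
    Complex.cpow_def_of_ne_zero h2, Complex.cpow_def_of_ne_zero (by exact_mod_cast hq0.ne'),
    ← Complex.exp_add, Complex.log_ofReal_mul hr h2, Real.log_rpow hq0, ← Complex.ofReal_log hq0.le]
  push_cast
  ring_nf

theorem three_term_prefactor (m n : ℤ) (ν : ℂ) :
    (q : ℂ) ^ (-((ν + m) * n / 2) + m * ν + (m : ℂ) * ((m : ℂ) - 1) / 2)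
      * (q : ℂ) ^ ((n : ℂ) / 2 * (ν + m)) = ((q : ℂ) ^ ν) ^ m * (q : ℂ) ^ tri m := by
  have hq : (q : ℂ) ≠ 0 := by exact_mod_cast hq0.ne'
  rw [← Complex.cpow_int_mul, ← Complex.cpow_intCast, ← Complex.cpow_add _ _ hq,
    ← Complex.cpow_add _ _ hq, cast_tri]
  congr 1
  ring

theorem R2_eq (m n : ℤ) (ν x : ℂ) :
    R2 q m n ν x = qPochInf ((q : ℂ) ^ ν * (q : ℂ) ^ (m + 1)) q
      / (qPochInf ((q : ℂ) ^ ν / q) q * ev ((x / 2) ^ 2) (polyE q n.toNat))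
      * (-1) ^ (max (m + 1) 0) * (((q : ℂ) ^ ν) ^ min (m + 1) 0 * (q : ℂ) ^ (tri m - 1))
      * (x / 2) ^ (min (m + 2) (-m)) * ev ((x / 2) ^ 2) (serP q ((q : ℂ) ^ ν) (m + 1) n) := by
  have hq : (q : ℂ) ≠ 0 := by exact_mod_cast hq0.ne'
  have e1 : (q : ℂ) ^ (ν + m + 1) = (q : ℂ) ^ ν * (q : ℂ) ^ (m + 1) := by
    rw [← cpow_add_intCast hq0]; push_cast; congr 1; ring
  have e2 : (q : ℂ) ^ (ν - 1) = (q : ℂ) ^ ν / q := by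
    rw [Complex.cpow_sub _ _ hq, Complex.cpow_one]
  have e3 : (q : ℂ) ^ (((min (m + 1) 0 : ℤ) : ℂ) * ν + (m : ℂ) * ((m : ℂ) - 1) / 2 - 1)
      = ((q : ℂ) ^ ν) ^ min (m + 1) 0 * (q : ℂ) ^ (tri m - 1) := by
    rw [← Complex.cpow_int_mul, ← Complex.cpow_intCast, ← Complex.cpow_add _ _ hq, ← cast_tri]
    push_cast
    congr 1
    ring
  have e4 : qPoch (-x ^ 2 / 4) q (max n 0) = ev ((x / 2) ^ 2) (polyE q n.toNat) := by
    rw [ev_polyE, show max n 0 = (n.toNat : ℤ) by omega, qPoch_natCast]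
    congr 1
    ring
  rw [R2, e1, e2, e3, e4, P2_eq_ev hq0]

theorem three_term (hq1 : q < 1) {m n : ℤ} {ν x : ℂ} (hA : Admissible q m n ν x) :
    (q : ℂ) ^ (-((ν + m) * n / 2) + m * ν + (m : ℂ) * ((m : ℂ) - 1) / 2)
        * J2 q (ν + m) (x * (q : ℂ) ^ ((n : ℂ) / 2))
      = R2 q m n ν x * J2 q ν x - R2 q (m - 1) n (ν + 1) x * J2 q (ν - 1) x := by
  have hq : (q : ℂ) ≠ 0 := by exact_mod_cast hq0.ne'
  have hqn : ‖(q : ℂ)‖ < 1 := by rwa [Complex.norm_real, Real.norm_of_nonneg hq0.le]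
  have hqk : ∀ k : ℤ, k ≠ 0 → (q : ℂ) ^ k ≠ 1 := fun k hk h => by
    have h' : q ^ k = 1 := by exact_mod_cast h
    exact hk ((zpow_eq_one_iff_right₀ hq0.le hq1.ne).1 h')
  have hu : (q : ℂ) ^ ν ≠ 0 := by simp [Complex.cpow_eq_zero_iff, hq]
  have hpre := three_term_prefactor hq0 m n ν
  have e1 : (q : ℂ) ^ (ν + 1) = (q : ℂ) ^ ν * q := by
    rw [Complex.cpow_add _ _ hq, Complex.cpow_one]
  have e2 : (q : ℂ) ^ (ν + m + 1) = (q : ℂ) ^ ν * (q : ℂ) ^ (m + 1) := by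
    rw [← cpow_add_intCast hq0]; push_cast; congr 1; ring
  have hν : ∀ k : ℕ, (q : ℂ) ^ ν / q * (q : ℂ) ^ k ≠ 1 := fun k => by
    have := hA.ν_reg k
    rwa [Complex.cpow_add _ _ hq, Complex.cpow_sub _ _ hq, Complex.cpow_one,
      Complex.cpow_natCast] at this
  have hνm : ∀ k : ℕ, (q : ℂ) ^ ν * (q : ℂ) ^ (m + 1) * (q : ℂ) ^ k ≠ 1 := fun k => by
    have := hA.νm_reg k
    rwa [Complex.cpow_add _ _ hq, e2, Complex.cpow_natCast] at this
  have hc := hA.coeff_reg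
  rw [cpow_two_sub hq0] at hc
  have hz : (x / 2) ^ 2 ≠ 0 := pow_ne_zero _ (div_ne_zero hA.x_ne two_ne_zero)
  have hw : x / 2 ≠ 0 := div_ne_zero hA.x_ne two_ne_zero
  have hE : ev ((x / 2) ^ 2) (polyE q n.toNat) ≠ 0 := by
    have := hA.x_reg
    rw [show max n 0 = (n.toNat : ℤ) by omega, qPoch_natCast] at this
    rw [ev_polyE]
    convert this using 2
    ring
  have rel := seriesRelation hq hqk hu hν hνm hc
  have e3 : (q : ℂ) ^ (ν - 1 + 1) = (q : ℂ) ^ ν := by rw [sub_add_cancel]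
  have e4 : (q : ℂ) ^ ν * q * (q : ℂ) ^ (m - 1 + 1) = (q : ℂ) ^ ν * (q : ℂ) ^ (m + 1) := by
    rw [sub_add_cancel, zpow_add_one₀ hq]; ring
  rw [J2_eq_ev, J2_eq_ev, J2_eq_ev, R2_eq hq0, R2_eq hq0, mul_cpow_half_div_two hq0 hA.x_ne,
    mul_cpow_half_div_two_sq, e1, e2, e3, e4, sub_add_cancel, mul_div_cancel_right₀ _ hq,
    Complex.cpow_add _ _ hw, Complex.cpow_sub _ _ hw, Complex.cpow_intCast, Complex.cpow_one]
  have h1 : ∀ k : ℕ, (q : ℂ) ^ ν * (q : ℂ) ^ k ≠ 1 := fun k hk =>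
    hν (k + 1) (by rw [pow_succ, ← hk]; field_simp)
  have h2 : ∀ k : ℕ, (q : ℂ) ^ ν * q * (q : ℂ) ^ k ≠ 1 := fun k => by
    rw [mul_assoc, ← pow_succ']; exact h1 _
  generalize (q : ℂ) ^ ν = u at *
  -- This produces the denominators (1 - u/q)(1 - u) of `SeriesRelation`; the infinite product left
  -- over cancels against the prefactor of J_ν.
  have hQ : qPochInf (u / q) q = (1 - u / q) * ((1 - u) * qPochInf (u * q) q) := by
    rw [qPochInf_eq_mul hqn, div_mul_cancel₀ _ hq, qPochInf_eq_mul hqn u]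
  have hQ0 : qPochInf u q ≠ 0 := qPochInf_ne_zero hqn h1
  have hQ1 : qPochInf (u * q) q ≠ 0 := qPochInf_ne_zero hqn h2
  have s1 : EvSummable ((x / 2) ^ 2) (ser2 q (u * q)) :=
    evSummable_ser2 hq hqn (mul_ne_zero hu hq) h2 hz
  have s2 : EvSummable ((x / 2) ^ 2) (ser2 q u) := evSummable_ser2 hq hqn hu h1 hz
  have s3 : EvSummable ((x / 2) ^ 2)
      (PowerSeries.rescale ((q : ℂ) ^ n) (ser2 q (u * (q : ℂ) ^ (m + 1)))) :=
    (evSummable_ser2 hq hqn (mul_ne_zero hu (zpow_ne_zero _ hq)) hνm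
      (mul_ne_zero (zpow_ne_zero _ hq) hz)).rescale
  have s4 : EvSummable ((x / 2) ^ 2) (serP q u (m + 1) n) :=
    evSummable_of_finite (coeff_serP_eq_zero _ _ _ _)
  have s5 : EvSummable ((x / 2) ^ 2) (serP q (u * q) m n) :=
    evSummable_of_finite (coeff_serP_eq_zero _ _ _ _)
  have sX : EvSummable ((x / 2) ^ 2) PowerSeries.X := by
    simpa using evSummable_X_pow ((x / 2) ^ 2) 1
  have eX : ev ((x / 2) ^ 2) PowerSeries.X = (x / 2) ^ 2 := by
    simpa using ev_X_pow ((x / 2) ^ 2) 1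
  have sE := evSummable_polyE (q : ℂ) ((x / 2) ^ 2) n.toNat
  have num := congrArg (ev ((x / 2) ^ 2)) rel
  rw [ev_mul (evSummable_C _ _) ((evSummable_X_pow _ _).mul (sE.mul s3)),
    ev_mul (evSummable_X_pow _ _) (sE.mul s3), ev_mul sE s3,
    ev_sub ((evSummable_C _ _).mul (sX.mul (s4.mul s1)))
      ((evSummable_C _ _).mul ((evSummable_X_pow _ _).mul (s5.mul s2))),
    ev_mul (evSummable_C _ _) (sX.mul (s4.mul s1)), ev_mul sX (s4.mul s1), ev_mul s4 s1,
    ev_mul (evSummable_C _ _) ((evSummable_X_pow _ _).mul (s5.mul s2)),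
    ev_mul (evSummable_X_pow _ _) (s5.mul s2), ev_mul s5 s2, ev_C, ev_C, ev_C, ev_X_pow, ev_X_pow,
    eX, ev_rescale] at num
  have x1 : (x / 2) ^ (min (m + 2) (-m)) * ((x / 2) ^ 2) ^ (m + 1).toNat
      = (x / 2) ^ m * (x / 2) ^ 2 := by
    rw [← pow_mul, ← zpow_natCast, ← zpow_natCast, ← zpow_add₀ hw, ← zpow_add₀ hw]
    congr 1
    push_cast
    omega
  have x2 : (x / 2) ^ (min (m - 1 + 2) (-(m - 1))) * ((x / 2) ^ 2) ^ (m + 1).toNat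
      = (x / 2) ^ m * ((x / 2) ^ 2) ^ ((m + 1).toNat - m.toNat) * (x / 2) := by
    rw [← pow_mul, ← pow_mul, ← zpow_natCast, ← zpow_natCast, ← zpow_add₀ hw, ← zpow_add₀ hw,
      ← zpow_add_one₀ hw]
    congr 1
    push_cast
    omega
  have hZ : ((x / 2) ^ 2) ^ (m + 1).toNat ≠ 0 := pow_ne_zero _ hz
  clear s1 s2 s3 s4 s5 sX sE eX rel
  generalize hpw : (q : ℂ) ^ (-((ν + m) * n / 2) + m * ν + (m : ℂ) * ((m : ℂ) - 1) / 2) = pw at *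
  generalize (q : ℂ) ^ ((n : ℂ) / 2 * (ν + m)) = pw' at *
  generalize ((x / 2) ^ 2) ^ (m + 1).toNat = Z at *
  generalize ((x / 2) ^ 2) ^ ((m + 1).toNat - m.toNat) = Z' at *
  generalize (x / 2) ^ (min (m + 2) (-m)) = y₁ at *
  generalize (x / 2) ^ (min (m - 1 + 2) (-(m - 1))) = y₂ at *
  generalize ev ((x / 2) ^ 2) (polyE q n.toNat) = E at *
  generalize ev ((x / 2) ^ 2) (serP q u (m + 1) n) = A₁ at *
  generalize ev ((x / 2) ^ 2) (serP q (u * q) m n) = A₂ at *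
  generalize ev ((x / 2) ^ 2) (ser2 q (u * q)) = F₁ at *
  generalize ev ((x / 2) ^ 2) (ser2 q u) = F₂ at *
  generalize ev ((q : ℂ) ^ n * (x / 2) ^ 2) (ser2 q (u * (q : ℂ) ^ (m + 1))) = F₃ at *
  generalize qPochInf (u * (q : ℂ) ^ (m + 1)) q = Q at *
  rw [hQ]
  generalize qPochInf (u * q) q = Q₁ at *
  generalize qPochInf u q = Q₀ at *
  generalize qPochInf (q : ℂ) q = Qq at *
  generalize (x / 2) ^ ν = v at *
  generalize (x / 2) ^ m = w at *
  generalize u ^ m * (q : ℂ) ^ tri m = p at *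
  exact three_term_clear_denominators hZ hE hw hQ0 hQ1 x1 x2 hpre num

end

end

/-! ### Ismail's `q`-Lommel polynomials -/

section

open Finset

/-- A form of `q`-Chu-Vandermonde free of division by e: the product of the e - c q^l stands for e^i
(c/e;q)_i. The induction passes from (c, e) to (cq, eq). -/
theorem sum_qVandermonde {q : ℂ} (hq : q ≠ 0) (hq1 : ∀ k : ℤ, k ≠ 0 → q ^ k ≠ 1) (j : ℕ) :
    ∀ {c : ℂ} (e : ℂ), (∀ i : ℕ, c * q ^ i ≠ 1) →
      ∑ i ∈ range (j + 1), (-1) ^ i * q ^ tri i * (∏ l ∈ range i, (e - c * q ^ l))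
        / (poch q q i * poch q q (j - i) * poch c q i)
      = poch e q j / (poch q q j * poch c q j) := by
  induction j with
  | zero => simp
  | succ j ih =>
    intro c e hc
    have hcq : ∀ i : ℕ, c * q * q ^ i ≠ 1 := fun i => by
      have := hc (i + 1)
      rwa [pow_succ', ← mul_assoc] at this
    have hj : poch q q (j + 1) ≠ 0 := poch_self_ne_zero hq1 _
    have hj' : 1 - q * q ^ j ≠ 0 := by rw [poch_succ] at hj; exact right_ne_zero_of_mul hj
    have key : (1 - q * q ^ j) * ∑ i ∈ range (j + 1 + 1), (-1) ^ i * q ^ tri i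
          * (∏ l ∈ range i, (e - c * q ^ l)) / (poch q q i * poch q q (j + 1 - i) * poch c q i)
        = (1 - e) / (1 - c) * ∑ i ∈ range (j + 1), (-1) ^ i * q ^ tri i
          * (∏ l ∈ range i, (e * q - c * q * q ^ l))
            / (poch q q i * poch q q (j - i) * poch (c * q) q i) := by
      have split : ∀ i ∈ range (j + 1 + 1), (1 - q * q ^ j) * ((-1) ^ i * q ^ tri i
            * (∏ l ∈ range i, (e - c * q ^ l)) / (poch q q i * poch q q (j + 1 - i) * poch c q i))
          = (-1) ^ i * q ^ tri i * (∏ l ∈ range i, (e - c * q ^ l))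
              / (poch q q i * poch q q (j + 1 - i) * poch c q i) * q ^ i * (1 - q ^ (j + 1 - i))
            + (-1) ^ i * q ^ tri i * (∏ l ∈ range i, (e - c * q ^ l))
              / (poch q q i * poch q q (j + 1 - i) * poch c q i) * (1 - q ^ i) := fun i hi => by
        have hi : i ≤ j + 1 := by simpa [Nat.lt_succ_iff] using hi
        have : q * q ^ j = q ^ (j + 1 - i) * q ^ i := by
          rw [← pow_add, Nat.sub_add_cancel hi, pow_succ']
        rw [this]
        ring
      rw [mul_sum, sum_congr rfl split, sum_add_distrib, sum_range_succ, sum_range_succ' (n := j + 1)]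
      simp only [Nat.sub_self, pow_zero, sub_self, mul_zero, add_zero]
      rw [← sum_add_distrib, mul_sum]
      refine sum_congr rfl fun i hi => ?_
      have hi : i ≤ j := by simpa [Nat.lt_succ_iff] using hi
      have h2 := poch_self_ne_zero hq1 (i + 1)
      have h4 := poch_self_ne_zero hq1 (j - i + 1)
      have h7 : 1 - c * q ^ i ≠ 0 := sub_ne_zero.2 (hc i).symm
      have h8 : poch c q i * (1 - c * q ^ i) = (1 - c) * poch (c * q) q i := by
        rw [← poch_succ, poch_succ']
      have h9 : ∏ l ∈ range i, (e * q - c * q * q ^ l) = q ^ i * ∏ l ∈ range i, (e - c * q ^ l) := by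
        rw [← card_range i, ← prod_const, card_range, ← prod_mul_distrib]
        exact prod_congr rfl fun l _ => by ring
      rw [show j + 1 - i = j - i + 1 by omega, show j + 1 - (i + 1) = j - i by omega,
        Nat.cast_succ i, tri_add, tri_one, add_zero, mul_one, zpow_add₀ hq, zpow_natCast,
        poch_succ c, h8, h9, prod_range_succ]
      rw [poch_succ] at h2 h4 ⊢
      rw [poch_succ q q i]
      have h10 := right_ne_zero_of_mul h2
      have h11 := right_ne_zero_of_mul h4
      have h12 : poch c q i = (1 - c) * poch (c * q) q i / (1 - c * q ^ i) := by
        rw [eq_div_iff h7, h8]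
      rw [h12, pow_succ' q (j - i), pow_succ' q i]
      field_simp
      ring
    rw [ih _ hcq] at key
    refine mul_left_cancel₀ hj' (key.trans ?_)
    rw [poch_succ q, poch_succ' c, poch_succ' e]
    generalize q ^ j = y at *
    field_simp

/-- The second `q`-Chu-Vandermonde sum, for `₂φ₁(q^(-j), b; c; q, c q^j / b)` with `e = c / b`. -/
theorem qChuVandermonde {q b c e : ℂ} (hq : q ≠ 0) (hq1 : ∀ k : ℤ, k ≠ 0 → q ^ k ≠ 1)
    (hc : ∀ i : ℕ, c * q ^ i ≠ 1) (he : e * b = c) (j : ℕ) :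
    ∑ i ∈ range (j + 1), poch (q ^ (-(j : ℤ))) q i * poch b q i / (poch q q i * poch c q i)
      * (e * q ^ j) ^ i = poch e q j / poch c q j := by
  have hj := poch_self_ne_zero hq1 j
  have key := sum_qVandermonde hq hq1 j e hc
  have h : poch e q j / poch c q j = poch q q j * (poch e q j / (poch q q j * poch c q j)) := by
    field_simp
  rw [h, ← key, mul_sum]
  refine sum_congr rfl fun i hi => ?_
  have hi : i ≤ j := by simpa [Nat.lt_succ_iff] using hi
  have h2 := poch_self_ne_zero hq1 (j - i)
  have h4 : ∏ l ∈ range i, (e - c * q ^ l) = e ^ i * poch b q i := by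
    rw [poch, ← card_range i, ← prod_const, card_range, ← prod_mul_distrib]
    exact prod_congr rfl fun l _ => by rw [← he]; ring
  have h5 := poch_zpow_neg hq hi
  have h6 : q ^ tri i = q ^ (tri i - i * j) * (q ^ j) ^ i := by
    rw [← pow_mul, ← zpow_natCast, ← zpow_add₀ hq]; congr 1; push_cast; ring
  rw [eq_div_iff_mul_eq h2 |>.2 h5, h4, h6, mul_pow]
  field_simp

theorem coeff_serP_zero {q u : ℂ} (hq : q ≠ 0) (hq1 : ∀ k : ℤ, k ≠ 0 → q ^ k ≠ 1) (hu : u ≠ 0)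
    (h : ∀ k : ℕ, u / q * q ^ k ≠ 1) {m k : ℕ} (hk : 2 * k ≤ m) :
    PowerSeries.coeff k (serP q u (m + 1) 0)
      = (-1) ^ (m + 1) * (-u) ^ k * poch (u / q) q (m + 2) / (poch q q k * q ^ (tri m - 1))
        * (q ^ (k * (k - 1) : ℤ) * poch u q (m - k) * poch q q (m - k)
          / (poch u q k * poch q q (m - 2 * k))) := by
  have h1 : ∀ i : ℕ, u * q ^ i ≠ 1 := fun i hi => h (i + 1) (by rw [pow_succ, ← hi]; field_simp)
  have hg : g (m + 1) 0 = (m / 2 : ℤ) := by unfold g; omega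
  have hN : ((k : ℤ) - (m + 1 : ℤ)) = -((m - k + 1 : ℕ) : ℤ) := by omega
  -- For n = 0 the argument q^(2k-m) equals e q^k with e = c/b = q^(k-m), exactly the summable case.
  have hsum := qChuVandermonde (b := u * q ^ ((m + 1 : ℤ) - k - 1)) (e := q ^ ((k : ℤ) - m)) hq hq1 h1
    (by rw [mul_left_comm, ← zpow_add₀ hq, show (k : ℤ) - m + (m + 1 - k - 1) = 0 by ring]; simp) k
  have ht : q ^ ((k : ℤ) - m) * q ^ k = q ^ (2 * (k : ℤ) - (m + 1) - 0 + 1) := by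
    rw [← zpow_natCast, ← zpow_add₀ hq]; congr 1; ring
  rw [ht] at hsum
  have hrev := poch_zpow_neg hq (show k ≤ m - k by omega)
  rw [show (-((m - k : ℕ) : ℤ)) = k - m by omega, show m - k - k = m - 2 * k by omega] at hrev
  have hq2 := poch_self_ne_zero hq1 (m - 2 * k)
  -- The index k - m - 1 is negative, so the reciprocal is a finite product; reversing its factors
  -- gives (u/q;q)_(m-k+1).
  have hinv : 1 / qPoch (q ^ (2 : ℤ) / u) q (k - (m + 1 : ℤ))
      = (-1) ^ (m - k + 1) / u ^ (m - k + 1)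
        * q ^ ((k + 1 - m : ℤ) * (m - k + 1) + tri (m - k + 1)) * poch (u / q) q (m - k + 1) := by
    rw [hN, qPoch_neg_natCast, one_div_one_div, poch, poch, ← prod_range_reflect]
    have e1 : (-1 : ℂ) ^ (m - k + 1) / u ^ (m - k + 1)
        * q ^ ((k + 1 - m : ℤ) * (m - k + 1) + tri (m - k + 1))
        = ∏ l ∈ range (m - k + 1), (-(q ^ (k + 1 - m : ℤ) / u) * q ^ (m - k + 1 - 1 - l)) := by
      rw [prod_range_reflect (fun l => -(q ^ (k + 1 - m : ℤ) / u) * q ^ l), prod_mul_distrib, prod_const, card_range, prod_pow_eq_pow_sum, sum_range_id,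
        ← Nat.choose_two_right, ← zpow_natCast q ((m - k + 1).choose 2), ← tri_natCast, neg_pow (_ / u),
        div_pow, ← zpow_natCast (q ^ (k + 1 - m : ℤ)), ← zpow_mul, zpow_add₀ hq]
      push_cast [show k ≤ m by omega]
      ring
    rw [e1, ← prod_mul_distrib]
    refine prod_congr rfl fun l hl => ?_
    have hl : l ≤ m - k := by simpa [Nat.lt_succ_iff] using hl
    have e2 : q ^ (2 : ℤ) / u * q ^ (-((m - k + 1 : ℕ) : ℤ)) * q ^ (m - k + 1 - 1 - l)
        = q ^ (1 - l : ℤ) / u := by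
      rw [div_mul_eq_mul_div, div_mul_eq_mul_div, ← zpow_natCast q (m - k + 1 - 1 - l),
        ← zpow_add₀ hq, ← zpow_add₀ hq]
      congr 2
      omega
    have e3 : -(q ^ (k + 1 - m : ℤ) / u) * q ^ (m - k + 1 - 1 - l) = -(q ^ (1 - l : ℤ) / u) := by
      rw [neg_mul, div_mul_eq_mul_div, ← zpow_natCast q (m - k + 1 - 1 - l), ← zpow_add₀ hq]
      congr 3
      omega
    rw [e2, e3, zpow_sub₀ hq, zpow_natCast, zpow_one]
    have : q ^ l ≠ 0 := pow_ne_zero _ hq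
    field_simp
    ring
  have hp1 : poch (u / q) q (m - k + 1) = (1 - u / q) * poch u q (m - k) := by
    rw [poch_succ', div_mul_cancel₀ _ hq]
  have hp2 : poch (u / q) q (m + 2) = (1 - u / q) * poch u q (m + 1) := by
    rw [poch_succ', div_mul_cancel₀ _ hq]
  have hcA : cA q u (m + 1) 0 k = poch u q (m + 1) / poch q q k
      * (1 / qPoch (q ^ (2 : ℤ) / u) q (k - (m + 1 : ℤ))) * u ^ (m - k + 1)
      * (poch (q ^ ((k : ℤ) - m)) q k / poch u q k) := by
    rw [cA, if_pos (Int.natCast_nonneg k), if_pos le_rfl, Int.toNat_natCast, termA, hsum, mul_zero,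
      zpow_zero, one_mul, show -((k : ℤ) - (m + 1) + 0) = ((m - k + 1 : ℕ) : ℤ) by omega,
      zpow_natCast, show ((m : ℤ) + 1) = ((m + 1 : ℕ) : ℤ) by push_cast; rfl, qPoch_natCast]
    ring
  rw [serP, PowerSeries.coeff_mk, if_pos (by omega), show (k : ℤ) + min (m + 1 : ℤ) 0 = k by omega,
    show cB q u (m + 1) 0 (k - max (m + 1 : ℤ) 0) = 0 by rw [cB, if_neg (by omega)], sub_zero,
    hcA, hinv, hp1, hp2, eq_div_iff_mul_eq hq2 |>.2 hrev]
  have hexp : q ^ ((k + 1 - m : ℤ) * (m - k + 1) + tri (m - k + 1)) * q ^ (tri k - k * ((m - k : ℕ) : ℤ))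
      = q ^ (k * (k - 1) : ℤ) / q ^ (tri m - 1) := by
    rw [← zpow_add₀ hq, ← zpow_sub₀ hq, Nat.cast_sub (by omega), tri_add, tri_sub, tri_one]
    congr 1
    have h2 := two_mul_tri k
    have h3 := two_mul_tri m
    linear_combination h2 + h3
  have hs : (-1 : ℂ) ^ (m - k + 1) * (-1) ^ k = (-1) ^ (m + 1) := by
    rw [← pow_add]; congr 1; omega
  calc _ = (-u) ^ k * (poch u q (m + 1) / poch q q k * (1 - u / q)) * ((-1 : ℂ) ^ (m - k + 1) * (-1) ^ k)
        * (q ^ ((k + 1 - m : ℤ) * (m - k + 1) + tri (m - k + 1))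
          * q ^ (tri k - k * ((m - k : ℕ) : ℤ))) * (u ^ (m - k + 1) / u ^ (m - k + 1))
        * (poch u q (m - k) * poch q q (m - k) / (poch u q k * poch q q (m - 2 * k))) := by ring
    _ = _ := by
      rw [hexp, hs, div_self (pow_ne_zero _ hu)]
      ring

theorem R2_zero_eq_ismailLommel {q : ℝ} (hq0 : 0 < q) (hq1 : q < 1) (m : ℕ) (ν : ℂ) {x : ℂ}
    (hx : x ≠ 0) (hν : ∀ k : ℕ, (q : ℂ) ^ (ν - 1 + k) ≠ 1) :
    R2 q m 0 ν x = ismailLommel q m ν x := by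
  have hq : (q : ℂ) ≠ 0 := by exact_mod_cast hq0.ne'
  have hqn : ‖(q : ℂ)‖ < 1 := by rwa [Complex.norm_real, Real.norm_of_nonneg hq0.le]
  have hqk : ∀ k : ℤ, k ≠ 0 → (q : ℂ) ^ k ≠ 1 := fun k hk h => by
    have h' : q ^ k = 1 := by exact_mod_cast h
    exact hk ((zpow_eq_one_iff_right₀ hq0.le hq1.ne).1 h')
  have hu : (q : ℂ) ^ ν ≠ 0 := by simp [Complex.cpow_eq_zero_iff, hq]
  have h : ∀ k : ℕ, (q : ℂ) ^ ν / q * (q : ℂ) ^ k ≠ 1 := fun k => by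
    have := hν k
    rwa [Complex.cpow_add _ _ hq, Complex.cpow_sub _ _ hq, Complex.cpow_one,
      Complex.cpow_natCast] at this
  have hw : x / 2 ≠ 0 := div_ne_zero hx two_ne_zero
  have hg : (g (m + 1) 0 + 1).toNat = m / 2 + 1 := by unfold g; omega
  -- Splitting off m + 2 factors leaves the infinite product in the numerator of R; the finite part
  -- cancels the one in `coeff_serP_zero`.
  have hinf := qPochInf_eq_poch_mul hqn ((q : ℂ) ^ ν / q) (m + 2)
  have e1 : (q : ℂ) ^ ν / q * (q : ℂ) ^ (m + 2) = (q : ℂ) ^ ν * (q : ℂ) ^ (m + 1 : ℤ) := by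
    rw [show (m : ℤ) + 1 = ((m + 1 : ℕ) : ℤ) by push_cast; rfl, zpow_natCast, pow_succ]; field_simp
  have hQ := qPochInf_ne_zero hqn h
  rw [hinf, e1] at hQ
  have hp := left_ne_zero_of_mul hQ
  have hQ' := right_ne_zero_of_mul hQ
  rw [R2_eq hq0, hinf, e1, ev_of_finite (coeff_serP_eq_zero _ _ _ _), hg, ismailLommel, mul_sum]
  refine sum_congr rfl fun k hk => ?_
  have hk : 2 * k ≤ m := by simp at hk; omega
  have e2 : (q : ℂ) ^ ((k : ℂ) * (ν + k - 1)) = ((q : ℂ) ^ ν) ^ k * (q : ℂ) ^ (k * (k - 1) : ℤ) := by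
    rw [← Complex.cpow_nat_mul, ← Complex.cpow_intCast, ← Complex.cpow_add _ _ hq]
    congr 1
    push_cast
    ring
  have e3 : (x / 2) ^ (2 * (k : ℤ) - m) = (x / 2) ^ (min (m + 2 : ℤ) (-m)) * ((x / 2) ^ 2) ^ k := by
    rw [← pow_mul, ← zpow_natCast, ← zpow_add₀ hw]
    congr 1
    push_cast
    omega
  rw [coeff_serP_zero hq hqk hu h hk, e2, e3, show (m : ℤ) - k = ((m - k : ℕ) : ℤ) by omega,
    show (m : ℤ) - 2 * k = ((m - 2 * k : ℕ) : ℤ) by omega]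
  simp only [qPoch_natCast]
  rw [show max ((m : ℤ) + 1) 0 = ((m + 1 : ℕ) : ℤ) by omega, zpow_natCast,
    show min ((m : ℤ) + 1) 0 = 0 by omega, zpow_zero, one_mul, neg_pow ((q : ℂ) ^ ν)]
  have h4 : (q : ℂ) ^ (tri m - 1) ≠ 0 := zpow_ne_zero _ hq
  have h5 : (-1 : ℂ) ^ (m + 1) * (-1) ^ (m + 1) = 1 := by rw [← mul_pow]; simp
  have e6 : ev ((x / 2) ^ 2) (polyE q (0 : ℤ).toNat) = 1 := by
    rw [ev_polyE]
    simp
  have e7 : qPochInf ((q : ℂ) ^ ν * (q : ℂ) ^ (m + 1 : ℤ)) q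
      / (poch ((q : ℂ) ^ ν / q) q (m + 2) * qPochInf ((q : ℂ) ^ ν * (q : ℂ) ^ (m + 1 : ℤ)) q * 1)
      = 1 / poch ((q : ℂ) ^ ν / q) q (m + 2) := by
    field_simp
  rw [e6, e7]
  generalize (q : ℂ) ^ ν = u at *
  calc _ = ((-1 : ℂ) ^ (m + 1) * (-1) ^ (m + 1)) * (poch (u / q) q (m + 2) / poch (u / q) q (m + 2))
        * ((q : ℂ) ^ (tri m - 1) / (q : ℂ) ^ (tri m - 1)) * ((x / 2) ^ (min (m + 2 : ℤ) (-m))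
          * ((x / 2) ^ 2) ^ k) * ((-1) ^ k * poch u q (m - k) * poch q q (m - k)
            / (poch q q k * poch u q k * poch q q (m - 2 * k))) * (u ^ k * (q : ℂ) ^ (k * (k - 1) : ℤ)) := by
        ring
    _ = _ := by
      rw [h5, div_self hp, div_self h4]
      ring

end

end QBessel

theorem theorem5 (q : ℝ) (hq0 : 0 < q) (hq1 : q < 1) :
    -- the three-term recurrence relation
    (∀ (m n : ℤ) (ν x : ℂ), QBessel.Admissible q m n ν x →
      (q : ℂ) ^ (-((ν + m) * n / 2) + m * ν + (m : ℂ) * ((m : ℂ) - 1) / 2)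
          * QBessel.J2 q (ν + m) (x * (q : ℂ) ^ ((n : ℂ) / 2))
        = QBessel.R2 q m n ν x * QBessel.J2 q ν x
          - QBessel.R2 q (m - 1) n (ν + 1) x * QBessel.J2 q (ν - 1) x) ∧
    -- `P^(2)_{m,n,ν}` is a polynomial in `x²` of degree at most `g m n`
    (∀ (m n : ℤ) (ν : ℂ), ∃ p : Polynomial ℂ,
      (∀ k : ℕ, QBessel.g m n < (k : ℤ) → p.coeff k = 0) ∧
      ∀ x : ℂ, QBessel.P2 q m n ν x = p.eval (x ^ 2)) ∧
    -- for `n = 0` and `m ≥ 0`, `R^(2)_{m,0,ν}` is Ismail's `q`-Lommel polynomial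
    (∀ (m : ℕ) (ν x : ℂ), x ≠ 0 → (∀ k : ℕ, (q : ℂ) ^ (ν - 1 + k) ≠ 1) →
      QBessel.R2 q m 0 ν x = QBessel.ismailLommel q m ν x) :=
  ⟨fun _ _ _ _ => QBessel.three_term hq0 hq1, QBessel.exists_polynomial_P2 q,
    fun m ν _ hx hν => QBessel.R2_zero_eq_ismailLommel hq0 hq1 m ν hx hν⟩
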